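/- Let $D_\infty=\langle a,t\mid a^2=t^2=1\rangle$ be the infinite dihedral group, $\mathbb Z_2=\{e,\tau\}$, and $D_{\infty h}=D_\infty\times\mathbb Z_2$. For a discrete group $G$ let $\lambda_G$ be its left regular representation on $\ell^2(G)$, and let $C^*_r(G)$ be the C*-algebra generated by $\lambda_G(G)$ (for the amenable groups considered here it coincides with $C^*(G)$), with its canonical trace $x\mapsto\langle x\delta_e,\delta_e\rangle$. Write $tr$ and $Tr$ for the canonical traces of $D_\infty$ and $D_{\infty h}$. For $z\in\mathbb C^4$ put $$R(z)=z_0\lambda(e)+z_1\lambda(a)+z_2\lambda(t)+z_3\lambda(\tau)\in C^*_r(D_{\infty h}),$$ let $P^c(R)\subset\mathbb C^4$ be the open set of $z$ for which $R(z)$ is invertible in $C^*_r(D_{\infty h})$, and let $\omega_R(z)=R(z)^{-1}dR(z)$ on $P^c(R)$. A continuous linear functional $\Phi$ on $C^*_r(D_{\infty h})$ induces the 1-form $\Phi(\omega_R)$ obtained by applying $\Phi$ to the coefficients. Let $\widetilde\phi$ be the linear functional on $C^*_r(\mathbb Z_2)$ with $\widetilde\phi(\lambda(e))=-1$ and $\widetilde\phi(\lambda(\tau))=1$.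 **Theorem.** There is a unique continuous linear functional $\widetilde\phi\otimes tr$ on $C^*_r(D_{\infty h})$ with $(\widetilde\phi\otimes tr)(x\otimes y)=tr(x)\,\widetilde\phi(y)$ for all $x\in C^*_r(D_\infty)$ and $y\in C^*_r(\mathbb Z_2)$. It is central, i.e. it takes the same value at $xy$ and $yx$, but it is not a tracial state: its value at the identity is $-1$. The 1-forms $(\widetilde\phi\otimes tr)(\omega_R)$ and $Tr(\omega_R)$ are smooth and closed on $P^c(R)$. Their classes in $H^1_{dR}(P^c(R);\mathbb C)$ are different, and indeed linearly independent over $\mathbb C$. In particular, $H^1_{dR}(P^c(R);\mathbb C)$ is not spanned by the class of $Tr(\omega_R)$, nor by any other single class. Moreover, let $H^1_{dR}(P^c(R);\mathbb Z)$ be the group of classes all of whose periods along closed loops in $P^c(R)$ are integers. Then the normalized classes $\frac1{\pi i}[(\widetilde\phi\otimes tr)(\omega_R)]$ and $\frac2{\pi i}[Tr(\omega_R)]$ belong to $H^1_{dR}(P^c(R);\mathbb Z)$, and this group is not cyclic. -/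

import Mathlib

open scoped ContDiff

noncomputable section

namespace JointSpectrum

/-! ### Projective joint spectrum and Maurer-Cartan form of a tuple in a Banach algebra -/

section Pencil

variable {n : ℕ} {B : Type*} [NormedRing B] [NormedAlgebra ℂ B]

/-- The linear pencil `A(z) = ∑ zᵢ Aᵢ`. -/
def pencil (A : Fin n → B) (z : Fin n → ℂ) : B := ∑ i, z i • A i

/-- The projective joint spectrum `P(A)`. -/
def jointSpectrum (A : Fin n → B) : Set (Fin n → ℂ) := {z | ¬ IsUnit (pencil A z)}

theorem isOpen_compl_jointSpectrum [CompleteSpace B] (A : Fin n → B) :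
    IsOpen (jointSpectrum A)ᶜ := by
  have hc : Continuous (pencil A) := by
    unfold pencil
    fun_prop
  have h : (jointSpectrum A)ᶜ = pencil A ⁻¹' {x : B | IsUnit x} := by
    ext z
    simp [jointSpectrum]
  rw [h]
  exact Units.isOpen.preimage hc

/-- The projective resolvent set `Pᶜ(A)`, as an open subset of `ℂⁿ`. -/
def projResolventSet [CompleteSpace B] (A : Fin n → B) : TopologicalSpace.Opens (Fin n → ℂ) :=
  ⟨(jointSpectrum A)ᶜ, isOpen_compl_jointSpectrum A⟩

/-- The Maurer-Cartan form `ω_A(z) = A(z)⁻¹ dA(z) = ∑ A(z)⁻¹ Aᵢ dzᵢ`, a `B`-valued 1-form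
(meaningful for `z` in the resolvent set, where `Ring.inverse` is the inverse). -/
def maurerCartan (A : Fin n → B) (z : Fin n → ℂ) : (Fin n → ℂ) →L[ℂ] B :=
  ∑ i, (ContinuousLinearMap.proj (R := ℂ) (φ := fun _ : Fin n => ℂ) i).smulRight
    (Ring.inverse (pencil A z) * A i)

/-- The scalar 1-form `φ(ω_A) = ∑ φ(A(z)⁻¹ Aᵢ) dzᵢ` induced by a functional `φ`, regarded as a
complex-valued 1-form on the real manifold `ℂⁿ`. -/
def inducedForm (φ : B →L[ℂ] ℂ) (A : Fin n → B) (z : Fin n → ℂ) : (Fin n → ℂ) →L[ℝ] ℂ :=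
  (φ.comp (maurerCartan A z)).restrictScalars ℝ

/-- A linear functional is central if `φ(xy) = φ(yx)`. -/
def IsCentral (φ : B →L[ℂ] ℂ) : Prop := ∀ x y, φ (x * y) = φ (y * x)

open scoped ComplexOrder in
/-- A tracial state: a central positive functional with value `1` at the unit. -/
def IsTracialState [StarRing B] (φ : B →L[ℂ] ℂ) : Prop :=
  IsCentral φ ∧ (∀ x, 0 ≤ φ (star x * x)) ∧ φ 1 = 1

end Pencil

/-! ### First de Rham cohomology of an open set, with complex and with integral coefficients -/

section DeRham

variable {E : Type*} [NormedAddCommGroup E] [NormedSpace ℝ E]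

/-- Complex-valued 1-forms on `E`. -/
abbrev OneForm (E : Type*) [NormedAddCommGroup E] [NormedSpace ℝ E] : Type _ := E → (E →L[ℝ] ℂ)

/-- A shortcut to the pointwise group structure. -/
instance : AddCommGroup (OneForm E) := Pi.addCommGroup

/-- Smooth closed complex-valued 1-forms on the open set `U`; closed means that
`dα(u, v) = (D_u α)(v) - (D_v α)(u)` vanishes on `U`. Values outside `U` are irrelevant:
they are killed in the quotient below. -/
def closedForms (U : TopologicalSpace.Opens E) : Submodule ℂ (OneForm E) where
  carrier := {α | (∀ z ∈ U, ContDiffAt ℝ ∞ α z) ∧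
    ∀ z ∈ U, ∀ u v : E, fderiv ℝ α z u v = fderiv ℝ α z v u}
  zero_mem' := by
    refine ⟨fun z _ => contDiffAt_const, fun z _ u v => ?_⟩
    have h : fderiv ℝ (0 : OneForm E) z = 0 := fderiv_const_apply 0
    rw [h]
    rfl
  add_mem' := by
    rintro α η ⟨h1, h2⟩ ⟨h3, h4⟩
    refine ⟨fun z hz => (h1 z hz).add (h3 z hz), fun z hz u v => ?_⟩
    have d1 := (h1 z hz).differentiableAt (by simp)
    have d2 := (h3 z hz).differentiableAt (by simp)
    rw [fderiv_add d1 d2]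
    simp [h2 z hz u v, h4 z hz u v]
  smul_mem' := by
    rintro c α ⟨h1, h2⟩
    refine ⟨fun z hz => (h1 z hz).const_smul c, fun z hz u v => ?_⟩
    have d1 := (h1 z hz).differentiableAt (by simp)
    rw [fderiv_const_smul d1]
    simp [h2 z hz u v]

/-- Exact 1-forms on `U`: those equal to `df` on `U` for a smooth function `f` on `U`. -/
def exactForms (U : TopologicalSpace.Opens E) : Submodule ℂ (closedForms U) where
  carrier := {α | ∃ f : E → ℂ, (∀ z ∈ U, ContDiffAt ℝ ∞ f z) ∧
    ∀ z ∈ U, (α : OneForm E) z = fderiv ℝ f z}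
  zero_mem' := by
    refine ⟨fun _ => 0, fun z _ => contDiffAt_const, fun z _ => ?_⟩
    rw [fderiv_const_apply]
    rfl
  add_mem' := by
    rintro α η ⟨f, h1, h2⟩ ⟨g, h3, h4⟩
    refine ⟨f + g, fun z hz => (h1 z hz).add (h3 z hz), fun z hz => ?_⟩
    rw [fderiv_add ((h1 z hz).differentiableAt (by simp))
      ((h3 z hz).differentiableAt (by simp)), ← h2 z hz, ← h4 z hz]
    rfl
  smul_mem' := by
    rintro c α ⟨f, h1, h2⟩
    refine ⟨c • f, fun z hz => (h1 z hz).const_smul c, fun z hz => ?_⟩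
    rw [fderiv_const_smul ((h1 z hz).differentiableAt (by simp)), ← h2 z hz]
    rfl

/-- `H¹_dR(U; ℂ)`: closed forms modulo exact forms. -/
abbrev deRhamH1 (U : TopologicalSpace.Opens E) : Type _ := closedForms U ⧸ exactForms U

/-- The cohomology class of a closed 1-form. -/
def cohomologyClass {U : TopologicalSpace.Opens E} (α : OneForm E)
    (h : α ∈ closedForms U) : deRhamH1 U :=
  (exactForms U).mkQ ⟨α, h⟩

/-- A closed `C¹` loop in `U`, parametrized by `[0, 1]`. -/
def IsLoopIn (U : TopologicalSpace.Opens E) (γ : ℝ → E) : Prop :=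
  ContDiff ℝ 1 γ ∧ γ 0 = γ 1 ∧ ∀ t ∈ Set.Icc (0 : ℝ) 1, γ t ∈ U

/-- The line integral `∫_γ α`. -/
def period (α : OneForm E) (γ : ℝ → E) : ℂ := ∫ t in (0 : ℝ)..1, α (γ t) (deriv γ t)

theorem intervalIntegrable_period {U : TopologicalSpace.Opens E} (α : closedForms U)
    {γ : ℝ → E} (hγ : IsLoopIn U γ) :
    IntervalIntegrable (fun t => (α : OneForm E) (γ t) (deriv γ t))
      MeasureTheory.volume 0 1 := by
  apply ContinuousOn.intervalIntegrable
  rw [Set.uIcc_of_le zero_le_one]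
  have h1 : ContinuousOn (fun t => (α : OneForm E) (γ t)) (Set.Icc (0 : ℝ) 1) :=
    fun t ht => ContinuousAt.continuousWithinAt
      (ContinuousAt.comp (f := γ) (α.2.1 _ (hγ.2.2 t ht)).continuousAt
        hγ.1.continuous.continuousAt)
  exact h1.clm_apply (hγ.1.continuous_deriv (by norm_num)).continuousOn

/-- Closed 1-forms on `U` all of whose periods along closed loops are integers. -/
def integralForms (U : TopologicalSpace.Opens E) : AddSubgroup (closedForms U) where
  carrier := {α | ∀ γ, IsLoopIn U γ → ∃ k : ℤ, period (α : OneForm E) γ = k}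
  zero_mem' := fun γ _ => ⟨0, by simp [period]⟩
  add_mem' := by
    intro α η h1 h2 γ hγ
    obtain ⟨k, hk⟩ := h1 γ hγ
    obtain ⟨l, hl⟩ := h2 γ hγ
    refine ⟨k + l, ?_⟩
    push_cast
    rw [← hk, ← hl]
    exact intervalIntegral.integral_add (intervalIntegrable_period α hγ)
      (intervalIntegrable_period η hγ)
  neg_mem' := by
    intro α h1 γ hγ
    obtain ⟨k, hk⟩ := h1 γ hγ
    refine ⟨-k, ?_⟩
    push_cast
    rw [← hk]
    exact intervalIntegral.integral_neg

/-- `H¹_dR(U; ℤ)`: the image of integral cohomology in `H¹_dR(U; ℂ)`, that is, the group of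
classes of closed forms with integral periods. -/
def integralH1 (U : TopologicalSpace.Opens E) : AddSubgroup (deRhamH1 U) :=
  (integralForms U).map (exactForms U).mkQ.toAddMonoidHom

end DeRham

/-! ### Reduced group C*-algebra -/

section Group

variable (G : Type*) [Group G]

/-- The Hilbert space `ℓ²(G)`. -/
abbrev ell2 : Type _ := lp (fun _ : G => ℂ) 2

variable {G}

open Classical in
/-- The basis vector `δ_g` of `ℓ²(G)`. -/
def delta (g : G) : ell2 G := lp.single 2 g (1 : ℂ)

theorem norm_rpow_translate (s : G) (f : ell2 G) :
    HasSum (fun t => ‖f (s⁻¹ * t)‖ ^ (2 : ENNReal).toReal) (‖f‖ ^ (2 : ENNReal).toReal) :=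
  (Equiv.mulLeft s⁻¹).hasSum_iff.2 (lp.hasSum_norm (by norm_num) f)

/-- Left translation `(λ(s) f)(t) = f(s⁻¹ t)` as a linear isometry of `ℓ²(G)`. -/
def leftTranslation (s : G) : ell2 G →ₗᵢ[ℂ] ell2 G where
  toFun f := ⟨fun t => f (s⁻¹ * t), memℓp_gen (norm_rpow_translate s f).summable⟩
  map_add' _ _ := rfl
  map_smul' _ _ := rfl
  norm_map' f := by
    have h2 : (0 : ℝ) < (2 : ENNReal).toReal := by norm_num
    have h := (lp.hasSum_norm h2 (⟨fun t => f (s⁻¹ * t),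
      memℓp_gen (norm_rpow_translate s f).summable⟩ : ell2 G)).unique (norm_rpow_translate s f)
    exact (Real.rpow_left_inj (norm_nonneg _) (norm_nonneg _) h2.ne').1 h

/-- The left regular representation `λ_G`, by bounded operators on `ℓ²(G)`. -/
def leftRegular (s : G) : ell2 G →L[ℂ] ell2 G := (leftTranslation s).toContinuousLinearMap

variable (G) in
/-- `C*_r(G)`: the C*-algebra of operators on `ℓ²(G)` generated by the left regular
representation. -/
abbrev reducedCStar : StarSubalgebra ℂ (ell2 G →L[ℂ] ell2 G) :=
  (StarAlgebra.adjoin ℂ (Set.range (leftRegular (G := G)))).topologicalClosure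

/-- `λ_G(g)` as an element of `C*_r(G)`. -/
def lam (g : G) : reducedCStar G :=
  ⟨leftRegular g, StarSubalgebra.le_topologicalClosure _
    (StarAlgebra.subset_adjoin ℂ _ ⟨g, rfl⟩)⟩

instance : CompleteSpace (reducedCStar G) :=
  (StarSubalgebra.isClosed_topologicalClosure _).completeSpace_coe

/-- The matrix coefficient functional `x ↦ ⟨x δ_g, δ_h⟩` on `C*_r(G)` (in the convention where
the inner product is linear in the first argument; Mathlib's is linear in the second). -/
def matrixCoeff (g h : G) : reducedCStar G →L[ℂ] ℂ :=
  (innerSL ℂ (delta h)).comp ((ContinuousLinearMap.apply ℂ (ell2 G) (delta g)).comp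
    (Subalgebra.toSubmodule (reducedCStar G).toSubalgebra).subtypeL)

variable (G) in
/-- The canonical trace `x ↦ ⟨x δ_e, δ_e⟩` on `C*_r(G)`. -/
def canonicalTrace : reducedCStar G →L[ℂ] ℂ := matrixCoeff 1 1

theorem matrixCoeff_apply (g h : G) (x : reducedCStar G) :
    matrixCoeff g h x = (x : ell2 G →L[ℂ] ell2 G) (delta g) h := by
  change inner ℂ (delta h) ((x : ell2 G →L[ℂ] ell2 G) (delta g)) = _
  classical
  unfold delta
  convert lp.inner_single_left (𝕜 := ℂ) (G := fun _ : G => ℂ) h (1 : ℂ) _ using 1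
  simp

theorem matrixCoeff_lam (s : G) (h : G) [Decidable (s = h)] :
    matrixCoeff 1 h (lam s) = if s = h then 1 else 0 := by
  rw [matrixCoeff_apply]
  change delta (1 : G) (s⁻¹ * h) = _
  classical
  unfold delta
  rw [lp.single_apply, Pi.single_apply]
  by_cases hh : s = h
  · simp [hh]
  · have : ¬ s⁻¹ * h = 1 := by
      rw [inv_mul_eq_one]
      exact hh
    simp [hh, this]

/-- `T ∈ C*_r(G × H)` is the elementary tensor `x ⊗ y` on `ℓ²(G × H) = ℓ²(G) ⊗ ℓ²(H)`. This
determines the operator `T`, as matrix coefficients do. -/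
def IsElementaryTensor {H : Type*} [Group H] (x : reducedCStar G) (y : reducedCStar H)
    (T : reducedCStar (G × H)) : Prop :=
  ∀ (g g' : G) (h h' : H),
    matrixCoeff (g, h) (g', h') T = matrixCoeff g g' x * matrixCoeff h h' y

/-- `Φ = φ ⊗ f`: the continuous functional `Φ` on `C*_r(G × H)` takes the value `f(x) φ(y)` at
`x ⊗ y` for all `x ∈ C*_r(G)`, `y ∈ C*_r(H)`. -/
def IsTensorFunctional {H : Type*} [Group H] (φ : reducedCStar H →L[ℂ] ℂ)
    (f : reducedCStar G →L[ℂ] ℂ) (Φ : reducedCStar (G × H) →L[ℂ] ℂ) : Prop :=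
  ∀ x y T, IsElementaryTensor x y T → Φ T = f x * φ y

end Group

/-! ### The group `D_∞h = D_∞ × ℤ₂` -/

/-- The infinite dihedral group. -/
abbrev Dinf : Type := DihedralGroup 0

/-- The group with two elements, written multiplicatively. -/
abbrev Z2 : Type := Multiplicative (ZMod 2)

/-- `D_∞h = D_∞ × ℤ₂`. -/
abbrev Dinfh : Type := Dinf × Z2

/-- The reflection `a` of `D_∞`. -/
def aD : Dinf := DihedralGroup.sr 0

/-- The reflection `t` of `D_∞`, so that `a t` is the generating rotation. -/
def tD : Dinf := DihedralGroup.sr 1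

/-- The generator `τ` of `ℤ₂`. -/
def tau : Z2 := Multiplicative.ofAdd 1

/-- The functional `φ̃ = φ₂ - φ₁` on `C*(ℤ₂)`, where `φ₁`, `φ₂` are the coefficient
functionals at `e` and `τ`. -/
def phiTilde : reducedCStar Z2 →L[ℂ] ℂ := matrixCoeff 1 tau - matrixCoeff 1 1

theorem tau_ne_one : tau ≠ 1 := by decide

theorem phiTilde_one : phiTilde (lam 1) = -1 := by
  simp [phiTilde, matrixCoeff_lam, tau_ne_one.symm]

theorem phiTilde_tau : phiTilde (lam tau) = 1 := by
  simp [phiTilde, matrixCoeff_lam, tau_ne_one]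

theorem aD_mul_tD : aD * tD = DihedralGroup.r 1 := rfl

theorem aD_sq : aD * aD = 1 := rfl

theorem tD_sq : tD * tD = 1 := rfl

/-- The tuple `(λ(e), λ(a), λ(t), λ(τ))` in `C*_r(D_∞h)`; its pencil is
`R(z) = z₀ λ(e) + z₁ λ(a) + z₂ λ(t) + z₃ λ(τ)`. -/
def gens : Fin 4 → reducedCStar Dinfh :=
  ![lam (1, 1), lam (aD, 1), lam (tD, 1), lam (1, tau)]

end JointSpectrum

end

open JointSpectrum

open scoped ContDiff

noncomputable section

namespace JointSpectrum

/-! ### Winding numbers -/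

section Winding

/-! The central involution `τ` splits the algebra into two components, indexed by `ε = ±1`, on which
`τ` acts as `ε` and `R(z)` becomes `(z₀ + ε z₃) + z₁ λ(a) + z₂ λ(t)`. With `componentTrace ε`
denoting twice the trace on the `ε`-component, `φ̃ ⊗ tr` is `-componentTrace (-1)`, while `Tr` is
half the sum of the two. All of these functionals are central, which makes the induced forms closed
(`inducedForm_mem_closedForms`).

Independence: for each `ε` there is a loop of scalar combinations of `1` and `λ(τ)` that winds once
around zero in the `ε`-component and is constantly `1` in the other. The periods along these two
loops separate the two classes (`linearIndependent_cohomologyClass`), and no single class can span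
both.

Integrality: multiplying the dihedral pencil by its conjugate under the sign character gives a norm
`q - p (u + u*)` with `u = λ(at)`, and the trace of the logarithmic derivative is half that of the
norm (`canonicalTrace_ringInverse_dihedralPencil_mul`). The spectrum of `u` is the whole circle, so
a loop of invertible norms is a loop of nowhere vanishing functions on a connected space. Their
winding numbers are integers independent of the point, so the integral of the logarithmic derivative
is a scalar in `2πi ℤ` (`exists_int_integral_map_logDeriv`). The factor one half puts the periods of
each component form in `πi ℤ` (`exists_int_period_componentTrace`), which explains the
normalizations `1/(πi)` and `2/(πi)`. -/

theorem exists_int_integral_logDeriv {h h' : ℝ → ℂ}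
    (hd : ∀ s ∈ Set.Icc (0 : ℝ) 1, HasDerivAt h (h' s) s)
    (hc : ContinuousOn h' (Set.Icc 0 1)) (h0 : ∀ s ∈ Set.Icc (0 : ℝ) 1, h s ≠ 0)
    (hl : h 0 = h 1) :
    ∃ k : ℤ, ∫ s in (0 : ℝ)..1, (h s)⁻¹ * h' s = k * (2 * Real.pi * Complex.I) := by
  have hcont : ContinuousOn h (Set.Icc 0 1) := fun s hs => (hd s hs).continuousAt.continuousWithinAt
  have hg : ContinuousOn (fun s => (h s)⁻¹ * h' s) (Set.Icc 0 1) := (hcont.inv₀ h0).mul hc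
  -- Extending the integrand continuously to the whole line makes its primitive `G` differentiable
  -- everywhere, endpoints included.
  set g : ℝ → ℂ := Set.IccExtend zero_le_one ((Set.Icc (0 : ℝ) 1).domRestrict
    fun s => (h s)⁻¹ * h' s) with hgdef
  have hgc : Continuous g := (continuousOn_iff_continuous_domRestrict.1 hg).Icc_extend'
  have hgeq : ∀ s ∈ Set.Icc (0 : ℝ) 1, g s = (h s)⁻¹ * h' s := fun s hs => by
    rw [hgdef, Set.IccExtend_of_mem _ _ hs]
    rfl
  have hint : ∫ s in (0 : ℝ)..1, (h s)⁻¹ * h' s = ∫ s in (0 : ℝ)..1, g s := by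
    refine intervalIntegral.integral_congr fun s hs => ?_
    rw [Set.uIcc_of_le zero_le_one] at hs
    exact (hgeq s hs).symm
  set G : ℝ → ℂ := fun x => ∫ s in (0 : ℝ)..x, g s with hG
  have hGd : ∀ s, HasDerivAt G (g s) s := fun s =>
    intervalIntegral.integral_hasDerivAt_right (hgc.intervalIntegrable _ _)
      (hgc.stronglyMeasurableAtFilter _ _) hgc.continuousAt
  -- `exp(-G) h` is constant; comparing its values at the endpoints of the loop gives `exp(G 1) =
  -- 1`.
  have hF : ∀ s ∈ Set.Icc (0 : ℝ) 1, HasDerivAt (fun s => Complex.exp (-G s) * h s) 0 s := by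
    intro s hs
    have h1 := ((hGd s).neg.cexp).mul (hd s hs)
    refine h1.congr_deriv ?_
    have := h0 s hs
    rw [hgeq s hs, neg_mul_eq_mul_neg, mul_assoc, ← mul_add]
    field_simp
    ring
  have hconst := constant_of_has_deriv_right_zero
    (f := fun s => Complex.exp (-G s) * h s) (a := 0) (b := 1)
    (fun s hs => (hF s hs).continuousAt.continuousWithinAt)
    (fun s hs => (hF s (Set.Ico_subset_Icc_self hs)).hasDerivWithinAt) 1 (by simp)
  have hG0 : G 0 = 0 := by simp [hG]
  simp only [hG0, neg_zero, Complex.exp_zero, one_mul, hl] at hconst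
  have hexp : Complex.exp (-G 1) = 1 := by
    have := h0 1 (by simp)
    exact mul_right_cancel₀ this (by rw [hconst, one_mul])
  rw [Complex.exp_neg, inv_eq_one] at hexp
  obtain ⟨k, hk⟩ := Complex.exp_eq_one_iff.1 hexp
  exact ⟨k, by rw [hint]; exact hk⟩

/-- A continuous function with values in a discrete additive subgroup `ℤ w` is constant on a
preconnected space. -/
theorem exists_int_forall_eq {X : Type*} [TopologicalSpace X] [PreconnectedSpace X] {f : X → ℂ}
    (hf : Continuous f) {w : ℂ} (hw : w ≠ 0) (h : ∀ x, ∃ k : ℤ, f x = k * w) :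
    ∃ k : ℤ, ∀ x, f x = k * w := by
  choose k hk using h
  have hk' : Continuous k := by
    have h1 : Continuous fun x => ((k x : ℤ) : ℝ) := by
      have : (fun x => ((k x : ℤ) : ℝ)) = fun x => (f x / w).re := by
        funext x
        rw [hk x, mul_div_cancel_right₀ _ hw, Complex.intCast_re]
      rw [this]
      fun_prop
    exact Int.isClosedEmbedding_coe_real.isEmbedding.continuous_iff.2 h1
  rcases isEmpty_or_nonempty X with hX | ⟨⟨x₀⟩⟩
  · exact ⟨0, fun x => isEmptyElim x⟩
  · refine ⟨k x₀, fun x => ?_⟩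
    rw [hk x, PreconnectedSpace.constant ‹_› hk' (x := x) (y := x₀)]

theorem map_ringInverse_of_isUnit {R S F : Type*} [MonoidWithZero R] [MonoidWithZero S]
    [FunLike F R S] [MonoidHomClass F R S] (f : F) {x : R} (hx : IsUnit x) :
    f (Ring.inverse x) = Ring.inverse (f x) := by
  obtain ⟨x, rfl⟩ := hx
  rw [Ring.inverse_unit]
  have : f (x : R) = (Units.map (f : R →* S) x : Sˣ) := rfl
  rw [this, Ring.inverse_unit]
  rfl

/-- In the commutative C*-algebra generated by a normal element `u` with connected spectrum, the
logarithmic derivative of a loop of invertible elements has integral in `2πi ℤ`, as seen by a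
unital functional. -/
theorem exists_int_integral_map_logDeriv {A : Type*} [CStarAlgebra A] (u : A) [IsStarNormal u]
    (hu : IsPreconnected (spectrum ℂ u)) (φ : A →L[ℂ] ℂ) (hφ : φ 1 = 1) {q p : ℝ → ℂ}
    (hq : ContDiff ℝ 1 q) (hp : ContDiff ℝ 1 p) (hq1 : q 0 = q 1) (hp1 : p 0 = p 1)
    (hD : ∀ s ∈ Set.Icc (0 : ℝ) 1, IsUnit (q s • (1 : A) - p s • (u + star u))) :
    ∃ k : ℤ, ∫ s in (0 : ℝ)..1, φ (Ring.inverse (q s • (1 : A) - p s • (u + star u)) *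
      (deriv q s • (1 : A) - deriv p s • (u + star u))) = k * (2 * Real.pi * Complex.I) := by
  have hun : IsStarNormal u := ‹_›
  set e : C(spectrum ℂ u, ℂ) →⋆ₐ[ℂ] A := cfcHom hun with he
  set i : C(spectrum ℂ u, ℂ) := ContinuousMap.restrict (spectrum ℂ u) (ContinuousMap.id ℂ) with hi
  have hei : e i = u := cfcHom_id hun
  set g : C(spectrum ℂ u, ℂ) := i + star i with hg
  have heg : e g = u + star u := by rw [hg, map_add, map_star, hei]
  have hf : ∀ a b : ℂ, e (a • 1 - b • g) = a • (1 : A) - b • (u + star u) := fun a b => by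
    rw [map_sub, map_smul, map_smul, map_one, heg]
  -- The spectrum of `e f` in `A` is the range of `f`, so invertibility in `A` means that the
  -- function has no zero.
  have hfu : ∀ s ∈ Set.Icc (0 : ℝ) 1, IsUnit (q s • (1 : C(spectrum ℂ u, ℂ)) - p s • g) := by
    intro s hs
    have h1 := spectrum.zero_notMem ℂ (hD s hs)
    rw [← hf, he, cfcHom_map_spectrum hun] at h1
    rw [ContinuousMap.isUnit_iff_forall_ne_zero]
    exact fun x hx => h1 ⟨x, hx⟩
  have hq' := hq.continuous
  have hp' := hp.continuous
  have hdq := hq.continuous_deriv (by norm_num)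
  have hdp := hp.continuous_deriv (by norm_num)
  set j : ℝ → C(spectrum ℂ u, ℂ) := fun s => Ring.inverse (q s • 1 - p s • g) *
    (deriv q s • 1 - deriv p s • g) with hj
  have hjc : ContinuousOn j (Set.Icc 0 1) := by
    intro s hs
    refine ContinuousAt.continuousWithinAt (ContinuousAt.mul ?_ ?_)
    · obtain ⟨v, hv⟩ := hfu s hs
      have h1 := NormedRing.inverse_continuousAt v
      rw [hv] at h1
      exact ContinuousAt.comp (f := fun s => q s • (1 : C(spectrum ℂ u, ℂ)) - p s • g) h1
        (by fun_prop)
    · fun_prop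
  have hji : IntervalIntegrable j MeasureTheory.volume 0 1 := by
    apply ContinuousOn.intervalIntegrable
    rwa [Set.uIcc_of_le zero_le_one]
  -- The integral is taken in the function algebra: its value at each point is `2πi` times a winding
  -- number, and it is continuous in the point, hence constant.
  set J := ∫ s in (0 : ℝ)..1, j s with hJ
  have hev : ∀ x, J x = ∫ s in (0 : ℝ)..1, j s x := fun x =>
    (ContinuousLinearMap.intervalIntegral_comp_comm (ContinuousMap.evalCLM ℂ x) hji).symm
  have hjx : ∀ s ∈ Set.Icc (0 : ℝ) 1, ∀ x, j s x =
      (q s - p s * g x)⁻¹ * (deriv q s - deriv p s * g x) := by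
    intro s hs x
    have h1 := congrArg (fun f : C(spectrum ℂ u, ℂ) => f x)
      (Ring.inverse_mul_cancel _ (hfu s hs))
    have h2 : (Ring.inverse (q s • 1 - p s • g) : C(spectrum ℂ u, ℂ)) x * (q s - p s * g x) = 1 := by
      simpa using h1
    have h3 := eq_inv_of_mul_eq_one_left h2
    simp only [hj, ContinuousMap.mul_apply, h3]
    simp
  have hne : ∀ s ∈ Set.Icc (0 : ℝ) 1, ∀ x, q s - p s * g x ≠ 0 := by
    intro s hs x
    simpa using (ContinuousMap.isUnit_iff_forall_ne_zero _).1 (hfu s hs) x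
  have : PreconnectedSpace (spectrum ℂ u) := isPreconnected_iff_preconnectedSpace.1 hu
  obtain ⟨k, hk⟩ := exists_int_forall_eq J.continuous Complex.two_pi_I_ne_zero (fun x => by
    have hd : ∀ s ∈ Set.Icc (0 : ℝ) 1, HasDerivAt (fun s => q s - p s * g x)
        (deriv q s - deriv p s * g x) s := fun s _ =>
      ((hq.differentiable (by norm_num)) s).hasDerivAt.sub
        (((hp.differentiable (by norm_num)) s).hasDerivAt.mul_const _)
    obtain ⟨k, hk⟩ := exists_int_integral_logDeriv hd (by fun_prop)
      (fun s hs => hne s hs x) (by simp only [hq1, hp1])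
    refine ⟨k, ?_⟩
    rw [hev, ← hk]
    refine intervalIntegral.integral_congr fun s hs => ?_
    rw [Set.uIcc_of_le zero_le_one] at hs
    exact hjx s hs x)
  refine ⟨k, ?_⟩
  have hJc : J = (k * (2 * Real.pi * Complex.I) : ℂ) • 1 := by
    ext x
    simp [hk x]
  -- Since `J` is a scalar, only the value of `φ` at `1` matters.
  let ψ : C(spectrum ℂ u, ℂ) →L[ℂ] ℂ :=
    φ.comp ⟨(e : C(spectrum ℂ u, ℂ) →ₐ[ℂ] A).toLinearMap, cfcHom_continuous hun⟩
  have hψ : ∀ f, ψ f = φ (e f) := fun f => rfl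
  calc _ = ∫ s in (0 : ℝ)..1, ψ (j s) := by
        refine intervalIntegral.integral_congr fun s hs => ?_
        rw [Set.uIcc_of_le zero_le_one] at hs
        simp only [hψ, hj]
        rw [map_mul e, map_ringInverse_of_isUnit e (hfu s hs), hf, hf]
    _ = ψ J := ContinuousLinearMap.intervalIntegral_comp_comm ψ hji
    _ = _ := by rw [hJc, map_smul, hψ, map_one, hφ, smul_eq_mul, mul_one]

end Winding

/-! ### Periods and the cohomology of induced forms -/

section Periods

variable {E : Type*} [NormedAddCommGroup E] [NormedSpace ℝ E]

theorem period_smul (c : ℂ) (α : OneForm E) (γ : ℝ → E) :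
    period (c • α) γ = c * period α γ :=
  intervalIntegral.integral_const_mul c _

/-- Fundamental theorem of calculus along the loop. Periods are thereby invariants of the cohomology
class, and they are what detects linear independence below. -/
theorem period_eq_zero_of_mem_exactForms {U : TopologicalSpace.Opens E} {α : closedForms U}
    (hα : α ∈ exactForms U) {γ : ℝ → E} (hγ : IsLoopIn U γ) : period (α : OneForm E) γ = 0 := by
  obtain ⟨f, hf, hfα⟩ := hα
  have hint := intervalIntegrable_period α hγ
  have h := intervalIntegral.integral_eq_sub_of_hasDerivAt (f := fun t => f (γ t))
    (f' := fun t => (α : OneForm E) (γ t) (deriv γ t)) (a := 0) (b := 1) (fun t ht => by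
      rw [Set.uIcc_of_le zero_le_one] at ht
      have hU := hγ.2.2 t ht
      rw [hfα _ hU]
      exact ((hf _ hU).differentiableAt (by simp)).hasFDerivAt.comp_hasDerivAt t
        ((hγ.1.differentiable (by norm_num)) t).hasDerivAt) hint
  rw [period, h, hγ.2.1, sub_self]

theorem smul_cohomologyClass_mem_integralH1 {U : TopologicalSpace.Opens E} {α : OneForm E}
    (hα : α ∈ closedForms U) (c : ℂ)
    (h : ∀ γ, IsLoopIn U γ → ∃ k : ℤ, c * period α γ = k) :
    c • cohomologyClass α hα ∈ integralH1 U := by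
  refine ⟨c • ⟨α, hα⟩, fun γ hγ => ?_, rfl⟩
  obtain ⟨k, hk⟩ := h γ hγ
  exact ⟨k, (period_smul c α γ).trans hk⟩

end Periods

/-! ### Smoothness and closedness of the forms induced by central functionals. -/

section InducedForm

variable {n : ℕ} {B : Type*} [NormedRing B] [NormedAlgebra ℂ B]

theorem maurerCartan_apply (A : Fin n → B) (z v : Fin n → ℂ) :
    maurerCartan A z v = Ring.inverse (pencil A z) * pencil A v := by
  simp [maurerCartan, pencil, Finset.mul_sum]

theorem inducedForm_apply (φ : B →L[ℂ] ℂ) (A : Fin n → B) (z v : Fin n → ℂ) :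
    inducedForm φ A z v = φ (Ring.inverse (pencil A z) * pencil A v) := by
  rw [← maurerCartan_apply]
  rfl

/-- The linear pencil as a continuous real-linear map. -/
def pencilCLM (A : Fin n → B) : (Fin n → ℂ) →L[ℝ] B :=
  (∑ i, (ContinuousLinearMap.proj (R := ℂ) (φ := fun _ : Fin n => ℂ) i).smulRight
    (A i)).restrictScalars ℝ

theorem pencilCLM_apply (A : Fin n → B) (z : Fin n → ℂ) : pencilCLM A z = pencil A z := by
  simp [pencilCLM, pencil]

variable [CompleteSpace B]

theorem isUnit_pencil_of_mem {A : Fin n → B} {z : Fin n → ℂ}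
    (hz : z ∈ projResolventSet A) : IsUnit (pencil A z) := not_not.1 hz

/-- The form induced by a central functional is smooth and closed on the resolvent set. -/
theorem inducedForm_mem_closedForms {φ : B →L[ℂ] ℂ} (hφ : IsCentral φ) (A : Fin n → B) :
    inducedForm φ A ∈ closedForms (projResolventSet A) := by
  let L : B →L[ℝ] ((Fin n → ℂ) →L[ℝ] ℂ) :=
    ((ContinuousLinearMap.compL ℝ (Fin n → ℂ) B ℂ (φ.restrictScalars ℝ)).comp
      (((ContinuousLinearMap.compL ℝ (Fin n → ℂ) B B).flip (pencilCLM A)).comp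
        (ContinuousLinearMap.mul ℝ B)))
  have hL : ∀ x v, L x v = φ (x * pencil A v) := fun x v => by
    rw [← pencilCLM_apply]
    rfl
  have hform : inducedForm φ A = fun z => L (Ring.inverse (pencilCLM A z)) := by
    funext z
    ext v
    rw [inducedForm_apply, hL, pencilCLM_apply]
  rw [hform]
  refine ⟨fun z hz => ?_, fun z hz v w => ?_⟩
  all_goals
    obtain ⟨x, hx⟩ := isUnit_pencil_of_mem hz
    rw [← pencilCLM_apply] at hx
  · have h1 : ContDiffAt ℝ ∞ Ring.inverse (pencilCLM A z) := hx ▸ contDiffAt_ringInverse ℝ x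
    exact L.contDiff.contDiffAt.comp z (h1.comp z (pencilCLM A).contDiff.contDiffAt)
  · have h1 := hasFDerivAt_ringInverse (𝕜 := ℝ) x
    rw [hx] at h1
    have h2 := (L.hasFDerivAt.comp z (h1.comp z (pencilCLM A).hasFDerivAt)).fderiv
    -- Differentiating the inverse gives `-x⁻¹ A(v) x⁻¹ A(w)` under `φ`; centrality of `φ` makes
    -- this symmetric in `v` and `w`.
    have h3 : ∀ v w, fderiv ℝ (fun z => L (Ring.inverse (pencilCLM A z))) z v w =
        -φ ((↑x⁻¹ * pencil A v) * (↑x⁻¹ * pencil A w)) := fun v w => by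
      change fderiv ℝ (L ∘ Ring.inverse ∘ pencilCLM A) z v w = _
      rw [h2]
      simp [hL, pencilCLM_apply, mul_assoc]
    rw [h3, h3, hφ]

end InducedForm

/-! ### The left regular representation -/

section Regular

variable {G : Type*} [Group G]

theorem leftRegular_one : leftRegular (1 : G) = 1 := by
  ext f t
  change f (1⁻¹ * t) = f t
  simp

theorem leftRegular_mul (s t : G) : leftRegular (s * t) = leftRegular s * leftRegular t := by
  ext f x
  change f ((s * t)⁻¹ * x) = f (t⁻¹ * (s⁻¹ * x))
  rw [mul_inv_rev, mul_assoc]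

theorem star_leftRegular (s : G) : star (leftRegular s) = leftRegular s⁻¹ := by
  have h : star (leftRegular s) * leftRegular s = 1 :=
    LinearIsometry.adjoint_comp_self (leftTranslation s)
  calc star (leftRegular s) = star (leftRegular s) * (leftRegular s * leftRegular s⁻¹) := by
        rw [← leftRegular_mul, mul_inv_cancel, leftRegular_one, mul_one]
    _ = leftRegular s⁻¹ := by rw [← mul_assoc, h, one_mul]

theorem leftRegular_mem_unitary (s : G) : leftRegular s ∈ unitary (ell2 G →L[ℂ] ell2 G) := by
  rw [Unitary.mem_iff, star_leftRegular, ← leftRegular_mul, ← leftRegular_mul, inv_mul_cancel,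
    mul_inv_cancel, leftRegular_one]
  exact ⟨rfl, rfl⟩

theorem lam_one : lam (1 : G) = 1 := Subtype.ext leftRegular_one

theorem lam_mul (s t : G) : lam (s * t) = lam s * lam t := Subtype.ext (leftRegular_mul s t)

theorem delta_apply {X : Type*} (g h : X) [Decidable (g = h)] : delta g h = if g = h then 1 else 0 := by
  classical
  unfold delta
  rw [lp.single_apply, Pi.single_apply]
  exact if_congr eq_comm rfl rfl

theorem matrixCoeff_lam_apply (s g h : G) [Decidable (s * g = h)] :
    matrixCoeff g h (lam s) = if s * g = h then 1 else 0 := by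
  classical
  rw [matrixCoeff_apply]
  change delta g (s⁻¹ * h) = _
  rw [delta_apply]
  exact if_congr eq_inv_mul_iff_mul_eq rfl rfl

theorem matrixCoeff_one_apply (s : G) (x : reducedCStar G) :
    matrixCoeff 1 s x = canonicalTrace G (lam s⁻¹ * x) := by
  rw [canonicalTrace, matrixCoeff_apply, matrixCoeff_apply]
  change _ = (x : ell2 G →L[ℂ] ell2 G) (delta 1) (s⁻¹⁻¹ * 1)
  simp

variable (G) in
-- The span of `λ(G)` is already closed under products and adjoints, so no further words are needed.
-- This is what gives density of the span in `C*_r(G)`.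
theorem adjoin_leftRegular_subset :
    (StarAlgebra.adjoin ℂ (Set.range (leftRegular (G := G))) : Set (ell2 G →L[ℂ] ell2 G)) ⊆
      Submodule.span ℂ (Set.range (leftRegular (G := G))) := by
  have hstar : ∀ x ∈ Submodule.span ℂ (Set.range (leftRegular (G := G))),
      star x ∈ Submodule.span ℂ (Set.range (leftRegular (G := G))) := by
    intro x h
    induction h using Submodule.span_induction with
    | mem x h =>
      obtain ⟨s, rfl⟩ := h
      rw [star_leftRegular]
      exact Submodule.subset_span ⟨_, rfl⟩
    | zero => simp
    | add x y _ _ h1 h2 =>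
      rw [star_add]
      exact add_mem h1 h2
    | smul c x _ h =>
      rw [star_smul]
      exact Submodule.smul_mem _ _ h
  intro x hx
  refine StarAlgebra.adjoin_induction
    (p := fun x _ => x ∈ Submodule.span ℂ (Set.range (leftRegular (G := G))))
    (fun x h => Submodule.subset_span h) (fun r => ?_) (fun x y _ _ h1 h2 => add_mem h1 h2)
    (fun x y _ _ h1 h2 => ?_) (fun x _ h => ?_) hx
  · rw [Algebra.algebraMap_eq_smul_one, ← leftRegular_one]
    exact Submodule.smul_mem _ _ (Submodule.subset_span ⟨1, rfl⟩)
  · have h3 := Submodule.mul_mem_mul h1 h2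
    rw [Submodule.span_mul_span] at h3
    refine Submodule.span_mono ?_ h3
    rintro _ ⟨_, ⟨s, rfl⟩, _, ⟨t, rfl⟩, rfl⟩
    exact ⟨s * t, leftRegular_mul s t⟩
  · exact hstar x h

theorem dense_span_lam :
    Dense (Submodule.span ℂ (Set.range (lam (G := G))) : Set (reducedCStar G)) := by
  intro x
  rw [closure_subtype]
  refine closure_mono ?_ x.2
  refine (adjoin_leftRegular_subset G).trans ?_
  have h : Submodule.span ℂ (Set.range (leftRegular (G := G))) =
      (Submodule.span ℂ (Set.range (lam (G := G)))).map
        (reducedCStar G).subtype.toAlgHom.toLinearMap := by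
    rw [Submodule.map_span, ← Set.range_comp]
    rfl
  rw [h]
  rintro _ ⟨y, hy, rfl⟩
  exact ⟨y, hy, rfl⟩

/-- Continuous functionals on `C*_r(G)` are determined by their values on `λ(G)`. -/
theorem reducedCStar_functional_ext {φ ψ : reducedCStar G →L[ℂ] ℂ}
    (h : ∀ g, φ (lam g) = ψ (lam g)) : φ = ψ := by
  refine DFunLike.coe_injective (Continuous.ext_on dense_span_lam φ.continuous ψ.continuous ?_)
  refine LinearMap.eqOn_span (f := φ.toLinearMap) (g := ψ.toLinearMap) ?_
  rintro _ ⟨g, rfl⟩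
  exact h g

/-- Density of the span of `λ(G)` is used twice, one variable at a time. -/
theorem isCentral_of_lam {φ : reducedCStar G →L[ℂ] ℂ}
    (h : ∀ s t, φ (lam (s * t)) = φ (lam (t * s))) : IsCentral φ := by
  let l (y : reducedCStar G) := φ.comp (ContinuousLinearMap.mul ℂ (reducedCStar G) y)
  let r (y : reducedCStar G) := φ.comp ((ContinuousLinearMap.mul ℂ (reducedCStar G)).flip y)
  have h1 : ∀ s, l (lam s) = r (lam s) := fun s => reducedCStar_functional_ext fun t => by
    change φ (lam s * lam t) = φ (lam t * lam s)
    rw [← lam_mul, ← lam_mul, h]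
  intro x y
  have h2 : l x = r x := reducedCStar_functional_ext fun t =>
    (DFunLike.congr_fun (h1 t) x).symm
  exact DFunLike.congr_fun h2 y

/-- For central `s`, conjugation shows that `gh = s` exactly when `hg = s`. Needed for `s = 1` and
for `s = (1, τ)`. -/
theorem isCentral_matrixCoeff {s : G} (hs : ∀ g, g * s = s * g) :
    IsCentral (matrixCoeff 1 s : reducedCStar G →L[ℂ] ℂ) := by
  classical
  refine isCentral_of_lam fun g h => ?_
  rw [matrixCoeff_lam, matrixCoeff_lam]
  refine if_congr ⟨fun hh => ?_, fun hh => ?_⟩ rfl rfl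
  · rw [← mul_right_inj g, ← mul_assoc, hh, hs]
  · rw [← mul_right_inj h, ← mul_assoc, hh, hs]

theorem isElementaryTensor_lam {H : Type*} [Group H] (g : G) (h : H) :
    IsElementaryTensor (lam g) (lam h) (lam (g, h)) := by
  classical
  intro g₁ g₂ h₁ h₂
  rw [matrixCoeff_lam_apply, matrixCoeff_lam_apply, matrixCoeff_lam_apply]
  simp only [Prod.mk_mul_mk, Prod.mk_inj, ite_and, ite_mul, one_mul, zero_mul]

theorem IsTensorFunctional.unique {H : Type*} [Group H] {φ : reducedCStar H →L[ℂ] ℂ}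
    {f : reducedCStar G →L[ℂ] ℂ} {Φ Ψ : reducedCStar (G × H) →L[ℂ] ℂ}
    (hΦ : IsTensorFunctional φ f Φ) (hΨ : IsTensorFunctional φ f Ψ) : Ψ = Φ :=
  reducedCStar_functional_ext fun ⟨g, h⟩ => by
    rw [hΦ _ _ _ (isElementaryTensor_lam g h), hΨ _ _ _ (isElementaryTensor_lam g h)]

/-- Spectral permanence for `C*_r(G)` in `B(ℓ²(G))`. -/
theorem isUnit_coe_reducedCStar {x : reducedCStar G} :
    IsUnit (x : ell2 G →L[ℂ] ell2 G) ↔ IsUnit x :=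
  StarSubalgebra.coe_isUnit _ (hS := StarSubalgebra.isClosed_topologicalClosure _)

/-- The functional `T ↦ ⟨T δ_e, δ_e⟩` on `B(ℓ²(G))`. -/
def vectorState (G : Type*) [Group G] : (ell2 G →L[ℂ] ell2 G) →L[ℂ] ℂ :=
  (innerSL ℂ (delta 1)).comp (ContinuousLinearMap.apply ℂ (ell2 G) (delta 1))

theorem canonicalTrace_one : canonicalTrace G 1 = 1 := by
  classical
  rw [← lam_one, canonicalTrace, matrixCoeff_lam, if_pos rfl]

theorem vectorState_coe (x : reducedCStar G) :
    vectorState G (x : ell2 G →L[ℂ] ell2 G) = canonicalTrace G x := rfl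

theorem coe_ringInverse {x : reducedCStar G} (hx : IsUnit x) :
    ((Ring.inverse x : reducedCStar G) : ell2 G →L[ℂ] ell2 G) = Ring.inverse ↑x :=
  map_ringInverse_of_isUnit (reducedCStar G).subtype hx

end Regular

/-! ### Multiplication by phases -/

section Phase

variable {G : Type*}

theorem norm_phase_mul (m : G → Circle) (f : G → ℂ) (t : G) :
    ‖(m t : ℂ) * f t‖ = ‖f t‖ := by
  rw [norm_mul, Circle.norm_coe, one_mul]

theorem memℓp_phase (m : G → Circle) (f : ell2 G) :
    Memℓp (fun t => (m t : ℂ) * f t) 2 := by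
  refine memℓp_gen ?_
  simp only [norm_phase_mul]
  exact (lp.hasSum_norm (by norm_num) f).summable

/-- Multiplication by a unimodular function on `ℓ²(G)`. -/
def phase (m : G → Circle) : ell2 G →L[ℂ] ell2 G :=
  LinearIsometry.toContinuousLinearMap
    { toFun := fun f => ⟨fun t => m t * f t, memℓp_phase m f⟩
      map_add' := fun f g => by
        ext t
        exact mul_add (m t : ℂ) (f t) (g t)
      map_smul' := fun c f => by
        ext t
        exact mul_left_comm (m t : ℂ) c (f t)
      norm_map' := fun f => by
        have h2 : (0 : ℝ) < (2 : ENNReal).toReal := by norm_num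
        have h1 := lp.hasSum_norm h2 f
        have h := lp.hasSum_norm h2 (⟨fun t => m t * f t, memℓp_phase m f⟩ : ell2 G)
        simp only [norm_phase_mul] at h
        exact (Real.rpow_left_inj (norm_nonneg _) (norm_nonneg _) h2.ne').1 (h.unique h1) }

theorem phase_mul_phase_inv (m : G → Circle) : phase m * phase m⁻¹ = 1 := by
  ext f t
  change (m t : ℂ) * ((m t)⁻¹ * f t) = f t
  simp

/-- `phase m` as an invertible operator. -/
def phaseUnit (m : G → Circle) : (ell2 G →L[ℂ] ell2 G)ˣ :=
  ⟨phase m, phase m⁻¹, phase_mul_phase_inv m, by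
    simpa using phase_mul_phase_inv (m⁻¹)⟩

variable [Group G]

/-- The phase `m` need not be a character: equivariance under left translation by the single element
`s` suffices. This freedom is used for the rotation, which has no suitable character on the dihedral
group. -/
theorem phase_mul_leftRegular {m : G → Circle} {s : G} {c : Circle}
    (h : ∀ t, m (s * t) = c * m t) :
    phase m * leftRegular s = (c : ℂ) • (leftRegular s * phase m) := by
  ext f t
  change (m t : ℂ) * f (s⁻¹ * t) = c * (m (s⁻¹ * t) * f (s⁻¹ * t))
  rw [← mul_assoc, ← Circle.coe_mul, ← h, mul_inv_cancel_left]

/-- `y = S x S⁻¹` for the multiplication operator `S` by `m`. -/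
def IsTwist (m : G → Circle) (x y : reducedCStar G) : Prop :=
  phase m * (x : ell2 G →L[ℂ] ell2 G) = (y : ell2 G →L[ℂ] ell2 G) * phase m

namespace IsTwist

variable {m : G → Circle} {x y x' y' : reducedCStar G}

theorem lam {s : G} {c : Circle} (h : ∀ t, m (s * t) = c * m t) :
    IsTwist m (lam s) ((c : ℂ) • JointSpectrum.lam s) :=
  (phase_mul_leftRegular h).trans (smul_mul_assoc _ _ _).symm

theorem one : IsTwist m 1 1 := by
  change phase m * 1 = 1 * phase m
  rw [mul_one, one_mul]

theorem add (h : IsTwist m x y) (h' : IsTwist m x' y') : IsTwist m (x + x') (y + y') := by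
  change phase m * (↑x + ↑x') = (↑y + ↑y') * phase m
  rw [mul_add, add_mul, h, h']

theorem smul (c : ℂ) (h : IsTwist m x y) : IsTwist m (c • x) (c • y) := by
  change phase m * (c • ↑x) = (c • ↑y) * phase m
  rw [mul_smul_comm, smul_mul_assoc, h]

theorem mul (h : IsTwist m x y) (h' : IsTwist m x' y') : IsTwist m (x * x') (y * y') := by
  change phase m * (↑x * ↑x') = (↑y * ↑y') * phase m
  rw [← mul_assoc, h, mul_assoc, h', mul_assoc]

theorem sub (h : IsTwist m x y) (h' : IsTwist m x' y') : IsTwist m (x - x') (y - y') := by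
  rw [sub_eq_add_neg, sub_eq_add_neg, ← neg_one_smul ℂ x', ← neg_one_smul ℂ y']
  exact h.add (h'.smul _)

theorem isUnit (h : IsTwist m x y) (hx : IsUnit x) : IsUnit y := by
  rw [← isUnit_coe_reducedCStar] at hx ⊢
  have h1 : (y : ell2 G →L[ℂ] ell2 G) = ↑(phaseUnit m) * ↑x * ↑(phaseUnit m)⁻¹ := by
    rw [Units.eq_mul_inv_iff_mul_eq]
    exact h.symm
  rw [h1]
  exact ((phaseUnit m).isUnit.mul hx).mul (phaseUnit m)⁻¹.isUnit

theorem ringInverse (h : IsTwist m x x) (hx : IsUnit x) :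
    IsTwist m (Ring.inverse x) (Ring.inverse x) := by
  have hc : Commute (phase m) (x : ell2 G →L[ℂ] ell2 G) := h
  change phase m * ↑(Ring.inverse x) = ↑(Ring.inverse x) * phase m
  rw [coe_ringInverse hx]
  obtain ⟨v, hv⟩ := isUnit_coe_reducedCStar.2 hx
  rw [← hv] at hc ⊢
  rw [Ring.inverse_unit]
  exact hc.units_inv_right.eq

/-- The vector `δ_e` is an eigenvector of the phase, with an eigenvalue of modulus one that cancels.
-/
theorem canonicalTrace_eq (h : IsTwist m x y) : canonicalTrace G x = canonicalTrace G y := by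
  have hd : phase m (delta 1) = (m 1 : ℂ) • delta (1 : G) := by
    classical
    ext t
    change (m t : ℂ) * delta 1 t = m 1 * delta 1 t
    rw [delta_apply]
    split_ifs with ht
    · rw [ht]
    · rw [mul_zero, mul_zero]
  have h1 := congrArg (fun T : ell2 G →L[ℂ] ell2 G => T (delta 1) 1) h
  change (m 1 : ℂ) * (x : ell2 G →L[ℂ] ell2 G) (delta 1) 1 =
    (y : ell2 G →L[ℂ] ell2 G) (phase m (delta 1)) 1 at h1
  rw [hd, map_smul] at h1
  rw [canonicalTrace, matrixCoeff_apply, matrixCoeff_apply]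
  exact mul_left_cancel₀ (Circle.coe_ne_zero (m 1)) h1

/-- This kills the traces of terms that are odd for one of the sign characters, even after
multiplication by an inverse whose Fourier coefficients are not known. -/
theorem canonicalTrace_eq_zero {c : ℂ} (h : IsTwist m x (c • x)) (hc : c ≠ 1) :
    canonicalTrace G x = 0 := by
  have h1 := h.canonicalTrace_eq
  rw [map_smul, smul_eq_mul] at h1
  by_contra h0
  exact hc (mul_right_cancel₀ h0 (by rw [one_mul, ← h1]))

end IsTwist

/-- The operator is unitary and conjugate to each of its multiples by a phase, so its spectrum is a
nonempty rotation-invariant subset of the circle. -/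
theorem spectrum_leftRegular_eq_sphere [Nontrivial (ell2 G →L[ℂ] ell2 G)] {s : G}
    (h : ∀ c : Circle, ∃ m : G → Circle, ∀ t, m (s * t) = c * m t) :
    spectrum ℂ (leftRegular s) = Metric.sphere 0 1 := by
  have hsub := spectrum.subset_circle_of_unitary (𝕜 := ℂ) (leftRegular_mem_unitary s)
  refine hsub.antisymm fun z hz => ?_
  obtain ⟨z₀, hz₀⟩ := spectrum.nonempty (leftRegular s)
  let c : Circle := ⟨z, by simpa [Submonoid.unitSphere] using hz⟩
  let c₀ : Circle := ⟨z₀, by simpa [Submonoid.unitSphere] using hsub hz₀⟩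
  obtain ⟨m, hm⟩ := h (c / c₀)
  have h1 : (phaseUnit m : ell2 G →L[ℂ] ell2 G) * leftRegular s * ↑(phaseUnit m)⁻¹ =
      Circle.toUnits (c / c₀) • leftRegular s := by
    rw [Units.mul_inv_eq_iff_eq_mul, smul_mul_assoc]
    exact phase_mul_leftRegular hm
  rw [← spectrum.units_conjugate (u := phaseUnit m), h1, spectrum.unit_smul_eq_smul]
  refine ⟨z₀, hz₀, ?_⟩
  change ((c / c₀ : Circle) : ℂ) * z₀ = z
  rw [Circle.coe_div]
  exact div_mul_cancel₀ z (Circle.coe_ne_zero c₀)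

end Phase

/-! ### The pencil of `D_∞h` -/

section Dinfh

theorem neg_one_ne_one : (-1 : ℂ) ≠ 1 := by norm_num

/-- The sign character of `D_∞`, as a character of `D_∞h`. -/
def reflSign : Dinfh → Circle
  | (DihedralGroup.r _, _) => 1
  | (DihedralGroup.sr _, _) => -1

/-- The sign character of `ℤ₂`, as a character of `D_∞h`. -/
def tauSign (g : Dinfh) : Circle := if g.2 = 1 then 1 else -1

/-- A phase which is multiplied by `c` under left translation by the rotation `at`. -/
def rotPhase (c : Circle) : Dinfh → Circle
  | (DihedralGroup.r i, _) => c ^ (show ℤ from i)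
  | (DihedralGroup.sr i, _) => c ^ (-(show ℤ from i))

/-- Left translation by the rotation raises the index of a rotation by one and lowers that of a
reflection by one, hence the opposite exponents in `rotPhase`. -/
theorem rotPhase_mul (c : Circle) (g : Dinfh) :
    rotPhase c ((DihedralGroup.r 1, 1) * g) = c * rotPhase c g := by
  obtain ⟨i | i, h⟩ := g
  · change c ^ (1 + (show ℤ from i)) = c * c ^ (show ℤ from i)
    rw [zpow_add, zpow_one]
  · change c ^ (-((show ℤ from i) - 1)) = c * c ^ (-(show ℤ from i))
    rw [neg_sub, sub_eq_add_neg, zpow_add, zpow_one]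

theorem isPreconnected_spectrum_rotation :
    IsPreconnected (spectrum ℂ (leftRegular ((DihedralGroup.r 1, 1) : Dinfh))) := by
  have : Nontrivial (ell2 Dinfh →L[ℂ] ell2 Dinfh) := by
    refine ⟨0, 1, fun h => ?_⟩
    have h1 := canonicalTrace_one (G := Dinfh)
    rw [← vectorState_coe] at h1
    have h2 : ((1 : reducedCStar Dinfh) : ell2 Dinfh →L[ℂ] ell2 Dinfh) = 0 := h.symm
    rw [h2, map_zero] at h1
    exact zero_ne_one h1
  rw [spectrum_leftRegular_eq_sphere fun c => ⟨rotPhase c, rotPhase_mul c⟩]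
  refine isPreconnected_sphere ?_ 0 1
  rw [Complex.rank_real_complex]
  exact Nat.one_lt_ofNat

/-- The generator `λ(a)`. -/
def lamA : reducedCStar Dinfh := lam (aD, 1)

/-- The generator `λ(t)`. -/
def lamT : reducedCStar Dinfh := lam (tD, 1)

/-- The generator `λ(τ)`. -/
def lamTau : reducedCStar Dinfh := lam (1, tau)

theorem lamA_mul_lamA : lamA * lamA = 1 := by
  rw [lamA, ← lam_mul, ← lam_one]
  rfl

theorem lamT_mul_lamT : lamT * lamT = 1 := by
  rw [lamT, ← lam_mul, ← lam_one]
  rfl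

theorem lamTau_mul_lamTau : lamTau * lamTau = 1 := by
  rw [lamTau, ← lam_mul, ← lam_one]
  rfl

theorem commute_lamTau_lamA : Commute lamTau lamA := by
  rw [Commute, SemiconjBy, lamA, lamTau, ← lam_mul, ← lam_mul]
  rfl

theorem commute_lamTau_lamT : Commute lamTau lamT := by
  rw [Commute, SemiconjBy, lamT, lamTau, ← lam_mul, ← lam_mul]
  rfl

/-- The pencil `w + b λ(a) + c λ(t)`. -/
def dihedralPencil (w b c : ℂ) : reducedCStar Dinfh := w • 1 + b • lamA + c • lamT

theorem pencil_gens (z : Fin 4 → ℂ) :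
    pencil gens z = dihedralPencil (z 0) (z 1) (z 2) + z 3 • lamTau := by
  rw [pencil, Fin.sum_univ_four, dihedralPencil, ← lam_one]
  rfl

theorem commute_lamTau_dihedralPencil (w b c : ℂ) : Commute lamTau (dihedralPencil w b c) :=
  ((((Commute.one_right _).smul_right _)).add_right (commute_lamTau_lamA.smul_right _)).add_right
    (commute_lamTau_lamT.smul_right _)

theorem isTwist_reflSign_lamA : IsTwist reflSign lamA ((-1 : ℂ) • lamA) :=
  IsTwist.lam (c := -1) fun g => by
    obtain ⟨i | i, h⟩ := g
    · exact (mul_one _).symm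
    · exact ((neg_mul_neg (1 : Circle) 1).trans (mul_one 1)).symm

theorem isTwist_reflSign_lamT : IsTwist reflSign lamT ((-1 : ℂ) • lamT) :=
  IsTwist.lam (c := -1) fun g => by
    obtain ⟨i | i, h⟩ := g
    · exact (mul_one _).symm
    · exact ((neg_mul_neg (1 : Circle) 1).trans (mul_one 1)).symm

/-! ### Splitting the pencil into its two components over the dual of `ℤ₂`. -/

theorem tauSign_mul (d : Dinf) (g : Dinfh) : tauSign ((d, 1) * g) = tauSign g := by
  simp [tauSign]

theorem isTwist_tauSign_dihedralPencil (w b c : ℂ) :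
    IsTwist tauSign (dihedralPencil w b c) (dihedralPencil w b c) := by
  have h : ∀ d : Dinf, IsTwist tauSign (lam (d, 1)) (lam (d, 1)) := fun d => by
    simpa using IsTwist.lam (c := 1) fun g => (tauSign_mul d g).trans (one_mul _).symm
  exact ((IsTwist.one.smul w).add ((h aD).smul b)).add ((h tD).smul c)

theorem isTwist_tauSign_lamTau : IsTwist tauSign lamTau ((-1 : ℂ) • lamTau) :=
  IsTwist.lam (c := -1) fun g => by
    obtain ⟨d, h⟩ := g
    have : h = 1 ∨ h = tau := by
      revert h
      decide
    obtain rfl | rfl := this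
    · exact (mul_one _).symm
    · exact ((neg_mul_neg (1 : Circle) 1).trans (mul_one 1)).symm

theorem dihedralPencil_add_smul_one (w b c d : ℂ) :
    dihedralPencil w b c + d • 1 = dihedralPencil (w + d) b c := by
  rw [dihedralPencil, dihedralPencil]
  module

/-- If `R(z)` is invertible, so are both of its components over the dual of `ℤ₂`. -/
theorem isUnit_dihedralPencil {w b c d : ℂ} (h : IsUnit (dihedralPencil w b c + d • lamTau)) :
    IsUnit (dihedralPencil (w + d) b c) ∧ IsUnit (dihedralPencil (w - d) b c) := by
  -- Twisting by the character of `ℤ₂` replaces `d` by `-d`. With `Z` the dihedral pencil, `(Z +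
  -- dτ)(Z - dτ) = Z² - d² = (Z + d)(Z - d)`, and commuting factors of a unit are units.
  have h1 : IsTwist tauSign (dihedralPencil w b c + d • lamTau)
      (dihedralPencil w b c + d • (-1 : ℂ) • lamTau) :=
    (isTwist_tauSign_dihedralPencil w b c).add (isTwist_tauSign_lamTau.smul d)
  have h2 := h.mul (h1.isUnit h)
  have hc := (commute_lamTau_dihedralPencil w b c).eq
  have h3 : (dihedralPencil w b c + d • lamTau) * (dihedralPencil w b c + d • (-1 : ℂ) • lamTau) =
      dihedralPencil (w + d) b c * dihedralPencil (w - d) b c := by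
    rw [sub_eq_add_neg w d, ← dihedralPencil_add_smul_one, ← dihedralPencil_add_smul_one]
    generalize dihedralPencil w b c = Z at hc
    simp only [add_mul, mul_add, smul_mul_assoc, mul_smul_comm, lamTau_mul_lamTau, hc, mul_one,
      one_mul]
    module
  have h4 : Commute (dihedralPencil (w + d) b c) (dihedralPencil (w - d) b c) := by
    rw [sub_eq_add_neg w d, ← dihedralPencil_add_smul_one, ← dihedralPencil_add_smul_one]
    generalize dihedralPencil w b c = Z
    simp only [Commute, SemiconjBy, add_mul, mul_add, smul_mul_assoc, mul_smul_comm, mul_one,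
      one_mul]
    module
  exact h4.isUnit_mul_iff.1 (h3 ▸ h2)

/-- The functional `x ↦ Tr((1 + ε τ) x)`, that is, twice the trace on the `ε`-component. -/
def componentTrace (ε : ℂ) : reducedCStar Dinfh →L[ℂ] ℂ :=
  matrixCoeff 1 1 + ε • matrixCoeff 1 (1, tau)

theorem componentTrace_apply (ε : ℂ) (x : reducedCStar Dinfh) :
    componentTrace ε x = canonicalTrace Dinfh ((1 + ε • lamTau) * x) := by
  have h : matrixCoeff 1 (1, tau) x = canonicalTrace Dinfh (lamTau * x) :=
    matrixCoeff_one_apply (1, tau) x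
  rw [add_mul, one_mul, smul_mul_assoc, map_add, map_smul, ← h]
  rfl

/-- If `R` and `X` agree on the component cut out by `P`, so do their inverses. It is applied with
`P = 1 + ετ`, twice a projection, so idempotence is not required. -/
theorem mul_ringInverse_mul_congr {A : Type*} [Ring A] {P R R' X X' : A} (hR : IsUnit R)
    (hX : IsUnit X) (hPR : Commute P R) (hPX : Commute P X) (h : P * R = P * X) (h' : P * R' = P * X') :
    P * (Ring.inverse R * R') = P * (Ring.inverse X * X') := by
  obtain ⟨x, rfl⟩ := hX
  obtain ⟨r, rfl⟩ := hR
  rw [Ring.inverse_unit, Ring.inverse_unit]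
  have h1 : P * (↑r⁻¹ : A) = ↑x⁻¹ * P := by
    rw [Units.mul_inv_eq_iff_eq_mul, mul_assoc, h, hPX.eq, Units.inv_mul_cancel_left]
  rw [← mul_assoc, h1, mul_assoc, h', ← mul_assoc, ← mul_assoc, hPX.units_inv_right.eq]

/-- Because `ε² = 1`, one has `(1 + ετ)τ = ε(1 + ετ)`: under the factor `1 + ετ`, `τ` may be
replaced by the scalar `ε`. -/
theorem componentTrace_ringInverse_mul {ε : ℂ} (hε : ε * ε = 1) {w b c d : ℂ}
    (h : IsUnit (dihedralPencil w b c + d • lamTau))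
    (h' : IsUnit (dihedralPencil (w + ε * d) b c)) (w' b' c' d' : ℂ) :
    componentTrace ε (Ring.inverse (dihedralPencil w b c + d • lamTau) *
        (dihedralPencil w' b' c' + d' • lamTau)) =
      canonicalTrace Dinfh (Ring.inverse (dihedralPencil (w + ε * d) b c) *
        dihedralPencil (w' + ε * d') b' c') := by
  have hPc : ∀ w b c, Commute (1 + ε • lamTau) (dihedralPencil w b c) := fun w b c =>
    (Commute.one_left _).add_left ((commute_lamTau_dihedralPencil w b c).smul_left _)
  have hPR : ∀ w b c d, (1 + ε • lamTau) * (dihedralPencil w b c + d • lamTau) =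
      (1 + ε • lamTau) * dihedralPencil (w + ε * d) b c := fun w b c d => by
    rw [← dihedralPencil_add_smul_one]
    generalize dihedralPencil w b c = Z
    simp only [add_mul, mul_add, one_mul, mul_one, smul_mul_assoc, mul_smul_comm,
      lamTau_mul_lamTau]
    rw [smul_add (ε * d), smul_smul, mul_right_comm, hε, one_mul]
    module
  -- Once `τ` is gone from the pencil, the remaining factor is invariant under `tauSign`, so
  -- multiplying it by `τ` gives an odd element of trace zero.
  have h0 : canonicalTrace Dinfh (lamTau * (Ring.inverse (dihedralPencil (w + ε * d) b c) *
      dihedralPencil (w' + ε * d') b' c')) = 0 := by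
    refine IsTwist.canonicalTrace_eq_zero (m := tauSign) (c := -1) ?_ neg_one_ne_one
    rw [← smul_mul_assoc]
    exact isTwist_tauSign_lamTau.mul (((isTwist_tauSign_dihedralPencil _ _ _).ringInverse h').mul
      (isTwist_tauSign_dihedralPencil _ _ _))
  rw [componentTrace_apply, mul_ringInverse_mul_congr h h'
    ((hPc _ _ _).add_right (((Commute.one_left _).add_left
      ((Commute.refl lamTau).smul_left _)).smul_right _)) (hPc _ _ _) (hPR _ _ _ _) (hPR _ _ _ _),
    add_mul, one_mul, smul_mul_assoc, map_add, map_smul, h0, smul_zero, add_zero]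

/-- The norm `q - p (at + ta)` of an element of the dihedral pencil. -/
def dihedralNorm (q p : ℂ) : reducedCStar Dinfh := q • 1 - p • (lamA * lamT + lamT * lamA)

theorem dihedralPencil_mul_dihedralPencil_neg (w b c : ℂ) :
    dihedralPencil w b c * dihedralPencil w (-b) (-c) =
      dihedralNorm (w ^ 2 - b ^ 2 - c ^ 2) (b * c) := by
  simp only [dihedralPencil, dihedralNorm, add_mul, mul_add, smul_mul_assoc, mul_smul_comm,
    lamA_mul_lamA, lamT_mul_lamT, mul_one, one_mul]
  module

theorem commute_lamA_dihedralNorm (q p : ℂ) : Commute lamA (dihedralNorm q p) := by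
  simp only [Commute, SemiconjBy, dihedralNorm, mul_sub, sub_mul, mul_add, add_mul,
    smul_mul_assoc, mul_smul_comm, mul_one, one_mul]
  rw [← mul_assoc lamA lamA, lamA_mul_lamA, mul_assoc lamT, lamA_mul_lamA, mul_assoc lamA, one_mul,
    mul_one]
  module

theorem commute_lamT_dihedralNorm (q p : ℂ) : Commute lamT (dihedralNorm q p) := by
  simp only [Commute, SemiconjBy, dihedralNorm, mul_sub, sub_mul, mul_add, add_mul,
    smul_mul_assoc, mul_smul_comm, mul_one, one_mul]
  rw [← mul_assoc lamT lamT, lamT_mul_lamT, mul_assoc lamA lamT lamT, lamT_mul_lamT,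
    mul_assoc lamT, one_mul, mul_one]
  module

theorem isTwist_reflSign_dihedralNorm (q p : ℂ) :
    IsTwist reflSign (dihedralNorm q p) (dihedralNorm q p) := by
  have h1 := isTwist_reflSign_lamA.mul isTwist_reflSign_lamT
  have h2 := isTwist_reflSign_lamT.mul isTwist_reflSign_lamA
  rw [smul_mul_smul_comm, neg_one_mul, neg_neg, one_smul] at h1 h2
  exact (IsTwist.one.smul q).sub ((h1.add h2).smul p)

theorem isUnit_dihedralNorm {w b c : ℂ} (h : IsUnit (dihedralPencil w b c)) :
    IsUnit (dihedralNorm (w ^ 2 - b ^ 2 - c ^ 2) (b * c)) := by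
  have h1 : IsTwist reflSign (dihedralPencil w b c) (dihedralPencil w (-b) (-c)) := by
    have := ((IsTwist.one (m := reflSign).smul w).add (isTwist_reflSign_lamA.smul b)).add
      (isTwist_reflSign_lamT.smul c)
    rwa [smul_smul, smul_smul, mul_neg_one, mul_neg_one] at this
  rw [← dihedralPencil_mul_dihedralPencil_neg]
  exact h.mul (h1.isUnit h)

/-- The trace of the logarithmic derivative of the pencil is half that of its norm. -/
theorem canonicalTrace_ringInverse_dihedralPencil_mul {w b c : ℂ}
    (h : IsUnit (dihedralPencil w b c)) (w' b' c' : ℂ) :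
    canonicalTrace Dinfh (Ring.inverse (dihedralPencil w b c) * dihedralPencil w' b' c') =
      1 / 2 * canonicalTrace Dinfh
        (Ring.inverse (dihedralNorm (w ^ 2 - b ^ 2 - c ^ 2) (b * c)) *
          dihedralNorm (2 * (w * w' - b * b' - c * c')) (b * c' + c * b')) := by
  have hD := isUnit_dihedralNorm h
  have hYD := dihedralPencil_mul_dihedralPencil_neg w b c
  set D := dihedralNorm (w ^ 2 - b ^ 2 - c ^ 2) (b * c) with hDdef
  set I := Ring.inverse D with hI
  have hA : lamA * I = I * lamA := by
    obtain ⟨v, hv⟩ := hD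
    have := commute_lamA_dihedralNorm (w ^ 2 - b ^ 2 - c ^ 2) (b * c)
    rw [← hDdef, ← hv] at this
    rw [hI, ← hv, Ring.inverse_unit]
    exact this.units_inv_right.eq
  have hT : lamT * I = I * lamT := by
    obtain ⟨v, hv⟩ := hD
    have := commute_lamT_dihedralNorm (w ^ 2 - b ^ 2 - c ^ 2) (b * c)
    rw [← hDdef, ← hv] at this
    rw [hI, ← hv, Ring.inverse_unit]
    exact this.units_inv_right.eq
  -- Inverse as conjugate divided by norm; the norm commutes with `λ(a)` and `λ(t)`.
  have hX : Ring.inverse (dihedralPencil w b c) = dihedralPencil w (-b) (-c) * I := by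
    calc _ = Ring.inverse (dihedralPencil w b c) * (D * I) := by
          rw [hI, Ring.mul_inverse_cancel _ hD, mul_one]
      _ = _ := by
          rw [← hYD, ← mul_assoc, ← mul_assoc, Ring.inverse_mul_cancel _ h, one_mul]
  have hIt := (isTwist_reflSign_dihedralNorm (w ^ 2 - b ^ 2 - c ^ 2) (b * c)).ringInverse hD
  have hA0 : canonicalTrace Dinfh (I * lamA) = 0 := by
    refine IsTwist.canonicalTrace_eq_zero (m := reflSign) (c := -1) ?_ neg_one_ne_one
    rw [← mul_smul_comm]
    exact hIt.mul isTwist_reflSign_lamA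
  have hT0 : canonicalTrace Dinfh (I * lamT) = 0 := by
    refine IsTwist.canonicalTrace_eq_zero (m := reflSign) (c := -1) ?_ neg_one_ne_one
    rw [← mul_smul_comm]
    exact hIt.mul isTwist_reflSign_lamT
  -- Traciality moves `λ(a)` to the front and commutation with `I` moves it past `I`. The
  -- coefficients of `at` and `ta` may then be averaged, which gives the differential of `bc`.
  have hAT : canonicalTrace Dinfh (I * (lamT * lamA)) = canonicalTrace Dinfh (I * (lamA * lamT)) := by
    have := isCentral_matrixCoeff (s := (1 : Dinfh)) (fun g => by rw [mul_one, one_mul])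
      (I * lamT) lamA
    rw [← mul_assoc lamA, hA, mul_assoc, mul_assoc] at this
    exact this
  rw [hX]
  simp only [dihedralPencil, dihedralNorm, mul_sub, add_mul, mul_add, smul_mul_assoc,
    mul_smul_comm, mul_one, one_mul, map_add, map_sub, map_smul, hA, hT, mul_assoc I,
    lamA_mul_lamA, lamT_mul_lamT, hA0, hT0, hAT, smul_eq_mul]
  ring

end Dinfh

/-! ### Periods of the component forms -/

section ComponentPeriods

theorem lamA_mul_lamT_coe : ((lamA * lamT : reducedCStar Dinfh) : ell2 Dinfh →L[ℂ] ell2 Dinfh) =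
    leftRegular (DihedralGroup.r 1, 1) :=
  (leftRegular_mul (aD, (1 : Z2)) (tD, (1 : Z2))).symm

theorem lamT_mul_lamA_coe : ((lamT * lamA : reducedCStar Dinfh) : ell2 Dinfh →L[ℂ] ell2 Dinfh) =
    star (leftRegular (DihedralGroup.r 1, 1)) := by
  rw [star_leftRegular]
  exact (leftRegular_mul (tD, (1 : Z2)) (aD, (1 : Z2))).symm

theorem coe_dihedralNorm (q p : ℂ) :
    (dihedralNorm q p : ell2 Dinfh →L[ℂ] ell2 Dinfh) =
      q • 1 - p • (leftRegular (DihedralGroup.r 1, 1) +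
        star (leftRegular (DihedralGroup.r 1, 1))) := by
  rw [← lamT_mul_lamA_coe, ← lamA_mul_lamT_coe]
  rfl

theorem exists_int_integral_dihedralNorm {q p : ℝ → ℂ} (hq : ContDiff ℝ 1 q)
    (hp : ContDiff ℝ 1 p) (hq1 : q 0 = q 1) (hp1 : p 0 = p 1)
    (hD : ∀ s ∈ Set.Icc (0 : ℝ) 1, IsUnit (dihedralNorm (q s) (p s))) :
    ∃ k : ℤ, ∫ s in (0 : ℝ)..1, canonicalTrace Dinfh (Ring.inverse (dihedralNorm (q s) (p s)) *
      dihedralNorm (deriv q s) (deriv p s)) = k * (2 * Real.pi * Complex.I) := by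
  have hu : IsStarNormal (leftRegular ((DihedralGroup.r 1, 1) : Dinfh)) :=
    isStarNormal_of_mem_unitary (leftRegular_mem_unitary _)
  obtain ⟨k, hk⟩ := exists_int_integral_map_logDeriv _ isPreconnected_spectrum_rotation
    (vectorState Dinfh) canonicalTrace_one hq hp hq1 hp1 (fun s hs => by
      rw [← coe_dihedralNorm]
      exact isUnit_coe_reducedCStar.2 (hD s hs))
  refine ⟨k, hk ▸ intervalIntegral.integral_congr fun s hs => ?_⟩
  rw [Set.uIcc_of_le zero_le_one] at hs
  simp only [← coe_dihedralNorm]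
  rw [← coe_ringInverse (hD s hs)]
  rfl

theorem inducedForm_componentTrace_apply {ε : ℂ} (hε : ε = 1 ∨ ε = -1) {z : Fin 4 → ℂ}
    (hz : z ∈ projResolventSet gens) (v : Fin 4 → ℂ) :
    IsUnit (dihedralPencil (z 0 + ε * z 3) (z 1) (z 2)) ∧
    inducedForm (componentTrace ε) gens z v =
      canonicalTrace Dinfh (Ring.inverse (dihedralPencil (z 0 + ε * z 3) (z 1) (z 2)) *
        dihedralPencil (v 0 + ε * v 3) (v 1) (v 2)) := by
  have h := isUnit_pencil_of_mem hz
  rw [pencil_gens] at h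
  have h' : IsUnit (dihedralPencil (z 0 + ε * z 3) (z 1) (z 2)) := by
    obtain rfl | rfl := hε
    · rw [one_mul]
      exact (isUnit_dihedralPencil h).1
    · rw [neg_one_mul, ← sub_eq_add_neg]
      exact (isUnit_dihedralPencil h).2
  refine ⟨h', ?_⟩
  rw [inducedForm_apply, pencil_gens, pencil_gens, componentTrace_ringInverse_mul _ h h']
  obtain rfl | rfl := hε <;> norm_num

/-- The functions `q` and `p` are the coefficients of the norm of the `ε`-component along the loop.
The norm has periods in `2πi ℤ`, and the trace sees half of them. -/
theorem exists_int_period_componentTrace {ε : ℂ} (hε : ε = 1 ∨ ε = -1) {γ : ℝ → Fin 4 → ℂ}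
    (hγ : IsLoopIn (projResolventSet gens) γ) :
    ∃ k : ℤ, period (inducedForm (componentTrace ε) gens) γ = k * (Real.pi * Complex.I) := by
  have hc : ∀ i, ContDiff ℝ 1 fun s => γ s i := fun i => contDiff_pi.1 hγ.1 i
  have hd : ∀ s i, HasDerivAt (fun s => γ s i) (deriv γ s i) s := fun s i =>
    hasDerivAt_pi.1 ((hγ.1.differentiable (by norm_num)) s).hasDerivAt i
  have h01 : ∀ i, γ 0 i = γ 1 i := fun i => congrFun hγ.2.1 i
  have hw : ContDiff ℝ 1 fun s => γ s 0 + ε * γ s 3 := (hc 0).add (contDiff_const.mul (hc 3))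
  set q : ℝ → ℂ := fun s => (γ s 0 + ε * γ s 3) ^ 2 - γ s 1 ^ 2 - γ s 2 ^ 2 with hq
  set p : ℝ → ℂ := fun s => γ s 1 * γ s 2 with hp
  have hqd : ∀ s, deriv q s = 2 * ((γ s 0 + ε * γ s 3) * (deriv γ s 0 + ε * deriv γ s 3) -
      γ s 1 * deriv γ s 1 - γ s 2 * deriv γ s 2) := fun s => by
    have h := ((((hd s 0).add ((hd s 3).const_mul ε)).pow 2).sub ((hd s 1).pow 2)).sub
      ((hd s 2).pow 2)
    refine (h.congr_deriv ?_).deriv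
    simp only [Pi.add_apply, Nat.cast_ofNat]
    ring
  have hpd : ∀ s, deriv p s = γ s 1 * deriv γ s 2 + γ s 2 * deriv γ s 1 := fun s => by
    refine (((hd s 1).mul (hd s 2)).congr_deriv ?_).deriv
    ring
  obtain ⟨k, hk⟩ := exists_int_integral_dihedralNorm (q := q) (p := p)
    (((hw.pow 2).sub ((hc 1).pow 2)).sub ((hc 2).pow 2)) ((hc 1).mul (hc 2))
    (by simp only [hq, h01]) (by simp only [hp, h01])
    (fun s hs => isUnit_dihedralNorm
      (inducedForm_componentTrace_apply hε (hγ.2.2 s hs) 0).1)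
  refine ⟨k, ?_⟩
  have h : period (inducedForm (componentTrace ε) gens) γ = ∫ s in (0 : ℝ)..1,
      1 / 2 * canonicalTrace Dinfh (Ring.inverse (dihedralNorm (q s) (p s)) *
        dihedralNorm (deriv q s) (deriv p s)) := by
    refine intervalIntegral.integral_congr fun s hs => ?_
    rw [Set.uIcc_of_le zero_le_one] at hs
    obtain ⟨h1, h2⟩ := inducedForm_componentTrace_apply hε (hγ.2.2 s hs) (deriv γ s)
    simp only [h2, canonicalTrace_ringInverse_dihedralPencil_mul h1, hqd, hpd]
    rfl
  rw [h, intervalIntegral.integral_const_mul, hk]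
  ring

/-- A loop winding once around the `ε`-component and constant on the other one. -/
def componentLoop (ε : ℂ) (s : ℝ) : Fin 4 → ℂ :=
  ![(Complex.exp (2 * Real.pi * Complex.I * s) + 1) / 2, 0, 0,
    ε * (Complex.exp (2 * Real.pi * Complex.I * s) - 1) / 2]

theorem mem_projResolventSet_of_sq_ne {x y : ℂ} (h : x ^ 2 - y ^ 2 ≠ 0) :
    ![x, 0, 0, y] ∈ projResolventSet gens := by
  change ¬ ¬ IsUnit (pencil gens ![x, 0, 0, y])
  rw [not_not, pencil_gens]
  have h1 : (x • 1 + y • lamTau) * (x • 1 - y • lamTau) =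
      (algebraMap ℂ (reducedCStar Dinfh)) (x ^ 2 - y ^ 2) := by
    simp only [add_mul, mul_sub, smul_mul_assoc, mul_smul_comm, mul_one, one_mul,
      lamTau_mul_lamTau, Algebra.algebraMap_eq_smul_one]
    module
  have h2 : Commute (x • 1 + y • lamTau) (x • 1 - y • lamTau) := by
    simp only [Commute, SemiconjBy, add_mul, mul_add, mul_sub, sub_mul, smul_mul_assoc,
      mul_smul_comm, mul_one, one_mul]
    module
  have h3 := (h2.isUnit_mul_iff.1 (h1 ▸ (IsUnit.mk0 _ h).map _)).1
  convert h3 using 1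
  simp [dihedralPencil]

theorem hasDerivAt_cexp_two_pi_I (s : ℝ) :
    HasDerivAt (fun s : ℝ => Complex.exp (2 * Real.pi * Complex.I * s))
      (2 * Real.pi * Complex.I * Complex.exp (2 * Real.pi * Complex.I * s)) s := by
  have h := ((Complex.ofRealCLM.hasDerivAt (x := s)).const_mul (2 * Real.pi * Complex.I)).cexp
  refine h.congr_deriv ?_
  simp
  ring

theorem isLoopIn_componentLoop {ε : ℂ} (hε : ε * ε = 1) :
    IsLoopIn (projResolventSet gens) (componentLoop ε) := by
  have he : ContDiff ℝ 1 fun s : ℝ => Complex.exp (2 * Real.pi * Complex.I * s) :=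
    (contDiff_const.mul Complex.ofRealCLM.contDiff).cexp
  refine ⟨contDiff_pi.2 fun i => ?_, ?_, fun s _ => mem_projResolventSet_of_sq_ne ?_⟩
  · fin_cases i
    · exact (he.add contDiff_const).div_const 2
    · exact contDiff_const
    · exact contDiff_const
    · exact (contDiff_const.mul (he.sub contDiff_const)).div_const 2
  · simp [componentLoop]
  -- The loop is built so that `z₀ + ε z₃` is the exponential and `z₀ - ε z₃ = 1`; this is their
  -- product.
  · have h : ((Complex.exp (2 * Real.pi * Complex.I * s) + 1) / 2) ^ 2 -
        (ε * (Complex.exp (2 * Real.pi * Complex.I * s) - 1) / 2) ^ 2 =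
        Complex.exp (2 * Real.pi * Complex.I * s) := by
      linear_combination (-(Complex.exp (2 * Real.pi * Complex.I * s) - 1) ^ 2 / 4) * hε
    rw [h]
    exact Complex.exp_ne_zero _

theorem hasDerivAt_componentLoop (ε : ℂ) (s : ℝ) :
    HasDerivAt (componentLoop ε)
      ![2 * Real.pi * Complex.I * Complex.exp (2 * Real.pi * Complex.I * s) / 2, 0, 0,
        ε * (2 * Real.pi * Complex.I * Complex.exp (2 * Real.pi * Complex.I * s)) / 2] s := by
  have he := hasDerivAt_cexp_two_pi_I s
  refine hasDerivAt_pi.2 fun i => ?_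
  fin_cases i
  · exact (he.add_const 1).div_const 2
  · exact hasDerivAt_const s 0
  · exact hasDerivAt_const s 0
  · exact ((he.sub_const 1).const_mul ε).div_const 2

theorem canonicalTrace_ringInverse_scalar_mul {w : ℂ} (hw : w ≠ 0) (w' : ℂ) :
    canonicalTrace Dinfh (Ring.inverse (dihedralPencil w 0 0) * dihedralPencil w' 0 0) =
      w' / w := by
  have h : ∀ w, dihedralPencil w 0 0 = algebraMap ℂ _ w := fun w => by
    simp [dihedralPencil, Algebra.algebraMap_eq_smul_one]
  rw [h, h, ← map_ringInverse_of_isUnit _ (IsUnit.mk0 w hw), ← map_mul, Ring.inverse_eq_inv',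
    Algebra.algebraMap_eq_smul_one, map_smul, canonicalTrace_one, smul_eq_mul, mul_one,
    div_eq_inv_mul]

/-- One formula for both cases: `δε = 1` gives the logarithmic derivative of the exponential, and
`δε = -1` that of the constant `1`. -/
theorem inducedForm_componentLoop {ε δ : ℂ} (hε : ε * ε = 1) (hδ : δ = 1 ∨ δ = -1) {s : ℝ}
    (hs : s ∈ Set.Icc (0 : ℝ) 1) :
    inducedForm (componentTrace δ) gens (componentLoop ε s) (deriv (componentLoop ε) s) =
      ((1 + δ * ε) / 2 * (2 * Real.pi * Complex.I * Complex.exp (2 * Real.pi * Complex.I * s))) /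
      ((1 + δ * ε) / 2 * Complex.exp (2 * Real.pi * Complex.I * s) + (1 - δ * ε) / 2) := by
  obtain ⟨h1, h2⟩ := inducedForm_componentTrace_apply hδ ((isLoopIn_componentLoop hε).2.2 s hs)
    (deriv (componentLoop ε) s)
  rw [h2, (hasDerivAt_componentLoop ε s).deriv]
  have hw : componentLoop ε s 0 + δ * componentLoop ε s 3 =
      (1 + δ * ε) / 2 * Complex.exp (2 * Real.pi * Complex.I * s) + (1 - δ * ε) / 2 := by
    simp only [componentLoop, Matrix.cons_val]
    ring
  have hne : (1 + δ * ε) / 2 * Complex.exp (2 * Real.pi * Complex.I * s) + (1 - δ * ε) / 2 ≠ 0 := by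
    have : (δ * ε - 1) * (δ * ε + 1) = 0 := by
      have hδ2 : δ * δ = 1 := by obtain rfl | rfl := hδ <;> norm_num
      linear_combination ε * ε * hδ2 + hε
    rcases mul_eq_zero.1 this with h | h
    · rw [sub_eq_zero.1 h]
      norm_num
    · rw [eq_neg_of_add_eq_zero_left h]
      norm_num
  rw [hw]
  change canonicalTrace Dinfh (Ring.inverse (dihedralPencil _ 0 0) * dihedralPencil _ 0 0) = _
  rw [canonicalTrace_ringInverse_scalar_mul hne]
  congr 1
  simp only [Matrix.cons_val]
  ring

theorem period_componentLoop_self {ε : ℂ} (hε : ε = 1 ∨ ε = -1) :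
    period (inducedForm (componentTrace ε) gens) (componentLoop ε) =
      2 * Real.pi * Complex.I := by
  have hε2 : ε * ε = 1 := by obtain rfl | rfl := hε <;> norm_num
  have h : period (inducedForm (componentTrace ε) gens) (componentLoop ε) =
      ∫ _ in (0 : ℝ)..1, 2 * Real.pi * Complex.I := by
    refine intervalIntegral.integral_congr fun s hs => ?_
    rw [Set.uIcc_of_le zero_le_one] at hs
    simp only [inducedForm_componentLoop hε2 hε hs, hε2]
    norm_num
  rw [h]
  simp

theorem period_componentLoop_neg {ε : ℂ} (hε : ε = 1 ∨ ε = -1) :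
    period (inducedForm (componentTrace (-ε)) gens) (componentLoop ε) = 0 := by
  have hε2 : ε * ε = 1 := by obtain rfl | rfl := hε <;> norm_num
  have h : period (inducedForm (componentTrace (-ε)) gens) (componentLoop ε) =
      ∫ _ in (0 : ℝ)..1, 0 := by
    refine intervalIntegral.integral_congr fun s hs => ?_
    rw [Set.uIcc_of_le zero_le_one] at hs
    simp only [inducedForm_componentLoop hε2
      (by obtain rfl | rfl := hε <;> norm_num : -ε = 1 ∨ -ε = -1) hs, neg_mul, hε2]
    norm_num
  rw [h]
  simp

end ComponentPeriods

/-! ### The functional `φ̃ ⊗ tr` and the trace -/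

section Functionals

/-- The functional `φ̃ ⊗ tr`. -/
def phiTildeTensorTrace : reducedCStar Dinfh →L[ℂ] ℂ :=
  matrixCoeff 1 (1, tau) - matrixCoeff 1 1

theorem isTensorFunctional_phiTildeTensorTrace :
    IsTensorFunctional phiTilde (canonicalTrace Dinf) phiTildeTensorTrace := by
  intro x y T hT
  have h1 := hT 1 1 1 tau
  have h2 := hT 1 1 1 1
  change matrixCoeff (1, 1) (1, tau) T - matrixCoeff (1, 1) (1, 1) T =
    matrixCoeff 1 1 x * (matrixCoeff 1 tau y - matrixCoeff 1 1 y)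
  rw [h1, h2, mul_sub]

theorem isCentral_canonicalTrace (G : Type*) [Group G] : IsCentral (canonicalTrace G) :=
  isCentral_matrixCoeff fun g => by rw [mul_one, one_mul]

theorem isCentral_phiTildeTensorTrace : IsCentral phiTildeTensorTrace := by
  intro x y
  have h1 : IsCentral (matrixCoeff 1 ((1, tau) : Dinfh)) :=
    isCentral_matrixCoeff fun ⟨g, h⟩ => by
      rw [Prod.mk_mul_mk, Prod.mk_mul_mk, mul_one, one_mul, mul_comm]
  have h2 := isCentral_canonicalTrace Dinfh x y
  change matrixCoeff 1 (1, tau) (x * y) - canonicalTrace Dinfh (x * y) =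
    matrixCoeff 1 (1, tau) (y * x) - canonicalTrace Dinfh (y * x)
  rw [h1 x y, h2]

theorem phiTildeTensorTrace_one : phiTildeTensorTrace 1 = -1 := by
  rw [← lam_one]
  have h := isTensorFunctional_phiTildeTensorTrace _ _ _ (isElementaryTensor_lam 1 1)
  rw [phiTilde_one, lam_one, canonicalTrace_one, one_mul] at h
  exact h

theorem isCentral_componentTrace (ε : ℂ) : IsCentral (componentTrace ε) := by
  intro x y
  -- Centrality is inherited from the two functionals already known to be central.
  have h : ∀ x, componentTrace ε x =
      (1 + ε) * canonicalTrace Dinfh x + ε * phiTildeTensorTrace x := fun x => by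
    change matrixCoeff 1 1 x + ε * matrixCoeff 1 (1, tau) x =
      (1 + ε) * matrixCoeff 1 1 x + ε * (matrixCoeff 1 (1, tau) x - matrixCoeff 1 1 x)
    ring
  rw [h, h, isCentral_canonicalTrace, isCentral_phiTildeTensorTrace]

theorem period_phiTildeTensorTrace (γ : ℝ → Fin 4 → ℂ) :
    period (inducedForm phiTildeTensorTrace gens) γ =
      -period (inducedForm (componentTrace (-1)) gens) γ := by
  rw [period, period, ← intervalIntegral.integral_neg]
  refine intervalIntegral.integral_congr fun s _ => ?_
  simp [inducedForm_apply, phiTildeTensorTrace, componentTrace, sub_eq_add_neg]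

theorem period_canonicalTrace {γ : ℝ → Fin 4 → ℂ} (hγ : IsLoopIn (projResolventSet gens) γ) :
    period (inducedForm (canonicalTrace Dinfh) gens) γ =
      1 / 2 * (period (inducedForm (componentTrace 1) gens) γ +
        period (inducedForm (componentTrace (-1)) gens) γ) := by
  have hi : ∀ ε, IntervalIntegrable
      (fun t => inducedForm (componentTrace ε) gens (γ t) (deriv γ t)) MeasureTheory.volume 0 1 :=
    fun ε => intervalIntegrable_period
      ⟨_, inducedForm_mem_closedForms (isCentral_componentTrace ε) gens⟩ hγ
  simp only [period]
  rw [← intervalIntegral.integral_add (hi _) (hi _), ← intervalIntegral.integral_const_mul]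
  refine intervalIntegral.integral_congr fun s _ => ?_
  simp only [inducedForm_apply, canonicalTrace, componentTrace, add_apply, smul_apply, smul_eq_mul]
  ring

theorem linearIndependent_cohomologyClass
    (hΦ : inducedForm phiTildeTensorTrace gens ∈ closedForms (projResolventSet gens))
    (hTr : inducedForm (canonicalTrace Dinfh) gens ∈ closedForms (projResolventSet gens)) :
    LinearIndependent ℂ ![cohomologyClass _ hΦ, cohomologyClass _ hTr] := by
  rw [LinearIndependent.pair_iff]
  intro x y hxy
  have hmem : x • (⟨_, hΦ⟩ : closedForms (projResolventSet gens)) + y • ⟨_, hTr⟩ ∈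
      exactForms (projResolventSet gens) := (Submodule.Quotient.mk_eq_zero _).1 hxy
  have hper : ∀ γ, IsLoopIn (projResolventSet gens) γ →
      x * period (inducedForm phiTildeTensorTrace gens) γ +
        y * period (inducedForm (canonicalTrace Dinfh) gens) γ = 0 := fun γ hγ => by
    rw [← period_eq_zero_of_mem_exactForms hmem hγ, ← period_smul, ← period_smul]
    exact (intervalIntegral.integral_add
      (intervalIntegrable_period (x • (⟨_, hΦ⟩ : closedForms (projResolventSet gens))) hγ)
      (intervalIntegrable_period (y • (⟨_, hTr⟩ : closedForms (projResolventSet gens))) hγ)).symm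
  -- The periods of `(φ̃ ⊗ tr, Tr)` are `(0, πi)` along the first loop and `(-2πi, πi)` along the
  -- second, a triangular system.
  have hl1 := isLoopIn_componentLoop (ε := 1) (by norm_num)
  have hl2 := isLoopIn_componentLoop (ε := -1) (by norm_num)
  have h1 := hper _ hl1
  have h2 := hper _ hl2
  have hn := period_componentLoop_neg (ε := -1) (Or.inr rfl)
  rw [neg_neg] at hn
  rw [period_phiTildeTensorTrace, period_canonicalTrace hl1, period_componentLoop_neg (Or.inl rfl),
    period_componentLoop_self (Or.inl rfl)] at h1
  rw [period_phiTildeTensorTrace, period_canonicalTrace hl2, hn,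
    period_componentLoop_self (Or.inr rfl)] at h2
  have hy : y = 0 := by
    refine (mul_eq_zero.1 (?_ : y * (2 * Real.pi * Complex.I) = 0)).resolve_right
      Complex.two_pi_I_ne_zero
    linear_combination 2 * h1
  have hx : x = 0 := by
    refine (mul_eq_zero.1 (?_ : x * (2 * Real.pi * Complex.I) = 0)).resolve_right
      Complex.two_pi_I_ne_zero
    rw [hy] at h2
    linear_combination -h2
  exact ⟨hx, hy⟩

theorem not_mem_span_singleton_of_linearIndependent {V : Type*} [AddCommGroup V] [Module ℂ V]
    {x y : V} (h : LinearIndependent ℂ ![x, y]) (c : V) (hx : x ∈ Submodule.span ℂ {c})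
    (hy : y ∈ Submodule.span ℂ {c}) : False := by
  obtain ⟨r, rfl⟩ := Submodule.mem_span_singleton.1 hx
  obtain ⟨s, rfl⟩ := Submodule.mem_span_singleton.1 hy
  have h0 := h.ne_zero 0
  obtain ⟨-, hr⟩ := LinearIndependent.pair_iff.1 h s (-r) (by
    rw [smul_smul, smul_smul, neg_mul, mul_comm s r, neg_smul, add_neg_cancel])
  exact h0 (by simp [neg_eq_zero.1 hr])

/-- Reduces non-cyclicity of the integral group to complex linear independence: a cyclic group lies
in one complex line. -/
theorem mem_span_singleton_of_smul_mem_zmultiples {V : Type*} [AddCommGroup V] [Module ℂ V]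
    {x c : V} {a : ℂ} (ha : a ≠ 0) (h : a • x ∈ AddSubgroup.zmultiples c) :
    x ∈ Submodule.span ℂ {c} := by
  obtain ⟨k, hk⟩ := AddSubgroup.mem_zmultiples_iff.1 h
  rw [← (Submodule.span ℂ {c}).smul_mem_iff ha, ← hk]
  exact zsmul_mem (Submodule.mem_span_singleton_self c) k

end Functionals

end JointSpectrum
end

open JointSpectrum
theorem theorem3p3 :
    ∃ Φ : reducedCStar Dinfh →L[ℂ] ℂ,
      -- `Φ` is the functional `φ̃ ⊗ tr`
      IsTensorFunctional phiTilde (canonicalTrace Dinf) Φ ∧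
      (∀ Ψ : reducedCStar Dinfh →L[ℂ] ℂ,
        IsTensorFunctional phiTilde (canonicalTrace Dinf) Ψ → Ψ = Φ) ∧
      -- it is central and is not a tracial state
      IsCentral Φ ∧ Φ 1 = -1 ∧ ¬ IsTracialState Φ ∧
      ∃ (hΦ : inducedForm Φ gens ∈ closedForms (projResolventSet gens))
        (hTr : inducedForm (canonicalTrace Dinfh) gens ∈ closedForms (projResolventSet gens)),
        -- the two classes are different, and neither is a multiple of the other
        cohomologyClass _ hΦ ≠ cohomologyClass _ hTr ∧
        LinearIndependent ℂ ![cohomologyClass _ hΦ, cohomologyClass _ hTr] ∧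
        -- `H¹_dR(Pᶜ; ℂ)` is not generated by the trace class, nor by any single class
        Submodule.span ℂ {cohomologyClass _ hTr} ≠ ⊤ ∧
        (∀ c : deRhamH1 (projResolventSet gens), Submodule.span ℂ {c} ≠ ⊤) ∧
        -- suitably normalized, the two classes are integral, and `H¹_dR(Pᶜ; ℤ)` is not cyclic
        (1 / (Real.pi * Complex.I : ℂ)) • cohomologyClass _ hΦ ∈
          integralH1 (projResolventSet gens) ∧
        (2 / (Real.pi * Complex.I : ℂ)) • cohomologyClass _ hTr ∈
          integralH1 (projResolventSet gens) ∧
        ∀ c : deRhamH1 (projResolventSet gens),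
          integralH1 (projResolventSet gens) ≠ AddSubgroup.zmultiples c := by
  have hΦ := inducedForm_mem_closedForms isCentral_phiTildeTensorTrace gens
  have hTr := inducedForm_mem_closedForms (isCentral_canonicalTrace Dinfh) gens
  have hLI := linearIndependent_cohomologyClass hΦ hTr
  have hspan : ∀ c : deRhamH1 (projResolventSet gens), Submodule.span ℂ {c} ≠ ⊤ := fun c hc =>
    not_mem_span_singleton_of_linearIndependent hLI c (hc ▸ Submodule.mem_top)
      (hc ▸ Submodule.mem_top)
  have hpi : (Real.pi * Complex.I : ℂ) ≠ 0 :=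
    mul_ne_zero (Complex.ofReal_ne_zero.2 Real.pi_ne_zero) Complex.I_ne_zero
  have hΦi : (1 / (Real.pi * Complex.I : ℂ)) • cohomologyClass _ hΦ ∈
      integralH1 (projResolventSet gens) :=
    smul_cohomologyClass_mem_integralH1 hΦ _ fun γ hγ => by
      obtain ⟨k, hk⟩ := exists_int_period_componentTrace (Or.inr rfl) hγ
      refine ⟨-k, ?_⟩
      rw [period_phiTildeTensorTrace, hk, Int.cast_neg]
      field_simp
  have hTri : (2 / (Real.pi * Complex.I : ℂ)) • cohomologyClass _ hTr ∈
      integralH1 (projResolventSet gens) :=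
    smul_cohomologyClass_mem_integralH1 hTr _ fun γ hγ => by
      obtain ⟨k, hk⟩ := exists_int_period_componentTrace (Or.inl rfl) hγ
      obtain ⟨l, hl⟩ := exists_int_period_componentTrace (Or.inr rfl) hγ
      refine ⟨k + l, ?_⟩
      rw [period_canonicalTrace hγ, hk, hl, Int.cast_add]
      field_simp
  refine ⟨phiTildeTensorTrace, isTensorFunctional_phiTildeTensorTrace,
    fun Ψ hΨ => isTensorFunctional_phiTildeTensorTrace.unique hΨ, isCentral_phiTildeTensorTrace,
    phiTildeTensorTrace_one, fun h => ?_, hΦ, hTr, ?_, hLI, hspan _, hspan, hΦi, hTri,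
    fun c hc => ?_⟩
  -- Only the normalization fails: the value at the unit is `-1` instead of `1`.
  · have h1 := h.2.2
    rw [phiTildeTensorTrace_one] at h1
    exact neg_one_ne_one h1
  · exact fun h => zero_ne_one (hLI.injective h : (0 : Fin 2) = 1)
  · rw [hc] at hΦi hTri
    exact not_mem_span_singleton_of_linearIndependent hLI c
      (mem_span_singleton_of_smul_mem_zmultiples (one_div_ne_zero hpi) hΦi)
      (mem_span_singleton_of_smul_mem_zmultiples (div_ne_zero two_ne_zero hpi) hTri)
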